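/- **Theorem (GNS for algebraic cross-ratios).** For a set $Y$ let $Y^{(4)}\subset Y^4$ be the set of quadruples of which at least three entries are distinct. An *abstract cross-ratio* on a topological space $Y$ is a continuous function $R\colon Y^{(4)}\to[0,\infty]$ such that, for all quadruples in $Y^{(4)}$, - $R(x,x',y,y')=R(y,y',x,x')=R(x',x,y',y)$, - $R(x,x',y,y')=R(y,x',x,y')^{-1}=R(x,y',y,x')^{-1}$, - $R(x,y,x',y')=R(x,y,x'',y')\,R(x'',y,x',y')$ whenever the three quadruples are in $Y^{(4)}$ and the product is not of the indeterminate form $0\cdot\infty$ or $\infty\cdot 0$, - $R(x,x',y,y')=0$ if and only if $x=x'$ or $y=y'$; $R(x,x',y,y')=\infty$ if and only if $x=y'$ or $y=x'$. It is *algebraic* if moreover, for every triple of distinct points of $Y$, denoted $0,1,\infty$, the kernel $K$ on $Y\setminus\{\infty\}$ given by $K(x,x)=0$ and, for $x\neq y$, $K(x,y)=\big(R(x,y,0,\infty)\,R(y,0,1,\infty)\big)^2$ (where for $y=0$ the product is read as $R(x,0,1,\infty)$) is conditionally of negative type: it is symmetric, and $\sum_{i,j}\lambda_i\lambda_jK(x_i,x_j)\le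 0$ for all finite families of points $x_i\in Y\setminus\{\infty\}$ and real numbers $\lambda_i$ with $\sum_i\lambda_i=0$. For a cardinal $\kappa$ let $\mathbf H^\kappa$ be the real hyperbolic space of dimension $\kappa$, i.e. the upper sheet $\{x_0^2-\|x'\|^2=1,\ x_0>0\}$ of the hyperboloid in $\mathbb R\oplus\ell^2(\kappa)$ with $\cosh d(x,y)=x_0y_0-\langle x',y'\rangle$. Let $\partial\mathbf H^\kappa$ be its Gromov boundary with its usual topology, and let $$[a,b;c,d]=\frac{d_o(a,b)\,d_o(c,d)}{d_o(a,d)\,d_o(c,b)}\in[0,\infty],\qquad d_o(\xi,\eta)=e^{-(\xi\mid\eta)_o},$$ be the boundary cross-ratio on $(\partial\mathbf H^\kappa)^{(4)}$; it does not depend on $o\in\mathbf H^\kappa$. A subset $A\subset\partial\mathbf H^\kappa$ is *total* if the only closed totally geodesic subspace of $\mathbf H^\kappa$ containing all geodesics between points of $A$ is $\mathbf H^\kappa$ itself. Distance-preserving maps are understood to be extended to the Gromov boundaries. Let $Y$ be a topological space with at least four points and let $R$ be an algebraic cross-ratio on $Y$. 1. There are a cardinal $\kappa$ and a continuous map $f\colon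 Y\to\partial\mathbf H^\kappa$ with total image such that $[f(x^-),f(x^+);f(y^-),f(y^+)]=R(x^-,x^+,y^-,y^+)$ for all $(x^-,x^+,y^-,y^+)\in Y^{(4)}$. 2. If $f_1\colon Y\to\partial\mathbf H^{\kappa_1}$ and $f_2\colon Y\to\partial\mathbf H^{\kappa_2}$ are two such maps, then $\kappa_1=\kappa_2$ and there is a unique isometry $\varphi\colon\mathbf H^{\kappa_1}\to\mathbf H^{\kappa_2}$ with $f_2=\varphi\circ f_1$; it is bijective, and is unique among all distance-preserving maps. 3. If a group $\Gamma$ acts on $Y$ preserving $R$, then for every such $f\colon Y\to\partial\mathbf H^\kappa$ there is a homomorphism $\rho\colon\Gamma\to\operatorname{Isom}(\mathbf H^\kappa)$ such that $f(\gamma y)=\rho(\gamma)f(y)$ for all $\gamma\in\Gamma$ and $y\in Y$. -/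

import Mathlib

open Filter Topology
open scoped ENNReal

universe u v

noncomputable section

/-! ## Gromov boundary, visual metametric and cross-ratio of a metric space -/

section GromovBoundary

variable {X : Type*} [MetricSpace X]

/-- The Gromov product `(x | y)_o`. -/
def gromovProduct (o x y : X) : ℝ := (dist o x + dist o y - dist x y) / 2

/-- The sequence `s` converges to infinity: `(s m | s n)_o → ∞` as `m, n → ∞`. -/
def ConvergesToInfinity (s : ℕ → X) : Prop :=
  ∀ o : X, Tendsto (fun p : ℕ × ℕ => gromovProduct o (s p.1) (s p.2)) atTop atTop

variable (X) in
/-- The sequences in `X` converging to infinity. -/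
def InfinitySeq : Type _ := {s : ℕ → X // ConvergesToInfinity s}

/-- Equivalence of sequences converging to infinity: `(s m | t n)_o → ∞` as `m, n → ∞`. -/
def InfinitySeq.Equivalent (s t : InfinitySeq X) : Prop :=
  ∀ o : X, Tendsto (fun p : ℕ × ℕ => gromovProduct o (s.1 p.1) (t.1 p.2)) atTop atTop

variable (X) in
/-- The Gromov boundary `∂X`: classes of sequences converging to infinity. (In a Gromov-hyperbolic
space `InfinitySeq.Equivalent` is an equivalence relation, so that this quotient is the set of its
classes.) -/
def GromovBoundary : Type _ := Quot (InfinitySeq.Equivalent (X := X))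

/-- The boundary point which is the limit of a sequence converging to infinity. -/
def InfinitySeq.limit (s : InfinitySeq X) : GromovBoundary X := Quot.mk _ s

/-- The Gromov product `(ξ | η)_o ∈ [0, ∞]` of two boundary points: the infimum of
`liminf (s m | t n)_o` over all sequences `s → ξ` and `t → η`. (In a strongly hyperbolic space these
lower limits are limits and do not depend on the sequences: this is the continuous extension of
the Gromov product to the boundary.) -/
def boundaryGromovProduct (o : X) (ξ η : GromovBoundary X) : ℝ≥0∞ :=
  ⨅ (s : InfinitySeq X) (t : InfinitySeq X) (_ : s.limit = ξ) (_ : t.limit = η),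
    liminf (fun p : ℕ × ℕ => ENNReal.ofReal (gromovProduct o (s.1 p.1) (t.1 p.2))) atTop

/-- The topology of `∂X`: the sets `{η | (ξ | η)_o > r}`, `r < ∞`, are a basis of neighbourhoods
of `ξ`. -/
instance GromovBoundary.instTopologicalSpace : TopologicalSpace (GromovBoundary X) where
  IsOpen U := ∀ ξ ∈ U, ∀ o : X, ∃ r : ℝ≥0∞, r < ∞ ∧
    ∀ η : GromovBoundary X, r < boundaryGromovProduct o ξ η → η ∈ U
  isOpen_univ := fun _ _ _ => ⟨0, ENNReal.zero_lt_top, fun _ _ => Set.mem_univ _⟩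
  isOpen_inter := by
    intro U V hU hV ξ hξ o
    obtain ⟨r, hr, h⟩ := hU ξ hξ.1 o
    obtain ⟨r', hr', h'⟩ := hV ξ hξ.2 o
    exact ⟨max r r', max_lt hr hr', fun η hη =>
      ⟨h η (lt_of_le_of_lt (le_max_left _ _) hη), h' η (lt_of_le_of_lt (le_max_right _ _) hη)⟩⟩
  isOpen_sUnion := by
    intro S hS ξ hξ o
    obtain ⟨U, hU, hξU⟩ := hξ
    obtain ⟨r, hr, h⟩ := hS U hU ξ hξU o
    exact ⟨r, hr, fun η hη => ⟨U, hU, h η hη⟩⟩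

/-- The visual distance `d_o(ξ, η) = exp (-(ξ | η)_o)` on the boundary, with `exp (-∞) = 0`. -/
def visualDist (o : X) (ξ η : GromovBoundary X) : ℝ≥0∞ :=
  EReal.exp (-(boundaryGromovProduct o ξ η : EReal))

/-- The boundary cross-ratio
`[a, b; c, d] = (d_o(a, b) * d_o(c, d)) / (d_o(a, d) * d_o(c, b)) ∈ [0, ∞]`, used for quadruples of
boundary points of which at least three are distinct. -/
def boundaryCrossRatio (o : X) (a b c d : GromovBoundary X) : ℝ≥0∞ :=
  (visualDist o a b * visualDist o c d) / (visualDist o a d * visualDist o c b)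

/-- The sequence `s` converges to the boundary point `ξ`. -/
def ConvergesToBoundary (s : ℕ → X) (ξ : GromovBoundary X) : Prop :=
  ∃ h : ConvergesToInfinity s, InfinitySeq.limit ⟨s, h⟩ = ξ

/-- `γ` is a bi-infinite geodesic from `ξ` to `η`. -/
def IsGeodesicLine (γ : ℝ → X) (ξ η : GromovBoundary X) : Prop :=
  Isometry γ ∧ ConvergesToBoundary (fun n : ℕ => γ (-(n : ℝ))) ξ ∧
    ConvergesToBoundary (fun n : ℕ => γ (n : ℝ)) η

/-- `S` is a totally geodesic (and geodesically complete) subspace: it contains every bi-infinite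
geodesic through any two of its points. -/
def IsTotallyGeodesic (S : Set X) : Prop :=
  ∀ γ : ℝ → X, Isometry γ → ∀ a b : ℝ, a ≠ b → γ a ∈ S → γ b ∈ S → ∀ r : ℝ, γ r ∈ S

/-- A set `A` of boundary points is total when the only closed totally geodesic subspace containing
all geodesics between points of `A` is the whole space. -/
def IsTotalBoundarySet (A : Set (GromovBoundary X)) : Prop :=
  ∀ S : Set X, IsClosed S → IsTotallyGeodesic S →
    (∀ γ : ℝ → X, ∀ ξ ∈ A, ∀ η ∈ A, IsGeodesicLine γ ξ η → ∀ r : ℝ, γ r ∈ S) →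
    S = Set.univ

theorem gromovProduct_base_change (o o' x y : X) :
    gromovProduct o x y - dist o o' ≤ gromovProduct o' x y := by
  unfold gromovProduct
  have h₁ := dist_triangle o o' x
  have h₂ := dist_triangle o o' y
  linarith

/-- The image under a distance-preserving map of a sequence converging to infinity. -/
def InfinitySeq.map {Z : Type*} [MetricSpace Z] (φ : X → Z) (hφ : Isometry φ)
    (s : InfinitySeq X) : InfinitySeq Z :=
  ⟨fun n => φ (s.1 n), fun o => by
    have h := s.2 (s.1 0)
    refine tendsto_atTop_mono (fun p => gromovProduct_base_change (φ (s.1 0)) o _ _) ?_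
    simp only [gromovProduct, hφ.dist_eq]
    exact tendsto_atTop_add_const_right _ _ h⟩

/-- The extension to the Gromov boundaries of a distance-preserving map `φ`, which sends the limit
of a sequence `s` to the limit of `φ ∘ s`. -/
def boundaryMap {Z : Type*} [MetricSpace Z] (φ : X → Z) (hφ : Isometry φ) :
    GromovBoundary X → GromovBoundary Z :=
  Quot.map (InfinitySeq.map φ hφ) (by
    intro s t hst o
    refine tendsto_atTop_mono (fun p => gromovProduct_base_change (φ (s.1 0)) o _ _) ?_
    simp only [gromovProduct, InfinitySeq.map, hφ.dist_eq]
    exact tendsto_atTop_add_const_right _ _ (hst (s.1 0)))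

end GromovBoundary

/-! ## The real algebraic hyperbolic spaces -/

section Hyperboloid

variable (E : Type*) [NormedAddCommGroup E] [InnerProductSpace ℝ E]

/-- The upper sheet `{x | x₀² - ‖x'‖² = 1, x₀ > 0}` of the hyperboloid in the Minkowski space
`ℝ ⊕ E`. -/
@[ext] structure Hyperboloid where
  time : ℝ
  space : E
  time_pos : 0 < time
  form_eq_one : time ^ 2 - ‖space‖ ^ 2 = 1

variable {E}

namespace Hyperboloid

/-- The Minkowski form `⟨x, y⟩ = x₀ y₀ - ⟪x', y'⟫`. -/
def form (x y : Hyperboloid E) : ℝ := x.time * y.time - inner ℝ x.space y.space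

theorem form_comm (x y : Hyperboloid E) : form x y = form y x := by
  unfold form
  rw [real_inner_comm, mul_comm]

theorem form_self (x : Hyperboloid E) : form x x = 1 := by
  unfold form
  rw [real_inner_self_eq_norm_sq, ← pow_two, x.form_eq_one]

theorem one_le_form (x y : Hyperboloid E) : 1 ≤ form x y := by
  unfold form
  have h := real_inner_le_norm x.space y.space
  have hx := x.form_eq_one
  have hy := y.form_eq_one
  have hp : 0 < x.time * y.time := mul_pos x.time_pos y.time_pos
  have h0 : 0 ≤ ‖x.space‖ * ‖y.space‖ := by positivity
  have key : 1 + ‖x.space‖ * ‖y.space‖ ≤ x.time * y.time := by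
    refine le_of_sq_le_sq ?_ hp.le
    have e : (x.time * y.time) ^ 2 = (1 + ‖x.space‖ ^ 2) * (1 + ‖y.space‖ ^ 2) := by
      rw [mul_pow]
      congr 1 <;> linarith
    rw [e]
    nlinarith [sq_nonneg (‖x.space‖ - ‖y.space‖)]
  linarith

/-- The Minkowski form is negative definite on the orthogonal complement of a point. -/
theorem sq_mul_le_of_orthogonal (y : Hyperboloid E) (a : ℝ) (w : E)
    (h : a * y.time = inner ℝ w y.space) : a ^ 2 + a ^ 2 * ‖y.space‖ ^ 2 ≤
      ‖w‖ ^ 2 * ‖y.space‖ ^ 2 := by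
  have h1 : (inner ℝ w y.space) ^ 2 ≤ (‖w‖ * ‖y.space‖) ^ 2 :=
    sq_le_sq' (by linarith [neg_le_of_abs_le (abs_real_inner_le_norm w y.space)])
      (real_inner_le_norm _ _)
  rw [← h] at h1
  have hy : y.time ^ 2 = 1 + ‖y.space‖ ^ 2 := by linarith [y.form_eq_one]
  rw [mul_pow, hy, mul_pow] at h1
  linarith

theorem sq_le_of_orthogonal (y : Hyperboloid E) (a : ℝ) (w : E)
    (h : a * y.time = inner ℝ w y.space) : a ^ 2 ≤ ‖w‖ ^ 2 := by
  have h1 := sq_mul_le_of_orthogonal y a w h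
  have h2 := y.form_eq_one
  by_contra hc
  push Not at hc
  nlinarith [sq_nonneg a, sq_nonneg ‖y.space‖,
    mul_nonneg (sub_nonneg.2 hc.le) (sq_nonneg ‖y.space‖), sq_nonneg ‖w‖]

theorem eq_of_form_eq_one (x y : Hyperboloid E) (h : form x y = 1) : x = y := by
  have hn := norm_sub_sq_real x.space y.space
  have hx := x.form_eq_one
  have hy := y.form_eq_one
  unfold form at h
  have h1 := sq_mul_le_of_orthogonal y (x.time - y.time) (x.space - y.space) (by
    rw [inner_sub_left, real_inner_self_eq_norm_sq]
    linear_combination h - hy)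
  have h2 : ‖x.space - y.space‖ ^ 2 = (x.time - y.time) ^ 2 := by
    rw [hn]
    linear_combination 2 * h - hx - hy
  rw [h2] at h1
  have h3 : (x.time - y.time) ^ 2 = 0 := le_antisymm (by linarith) (sq_nonneg _)
  rw [h3] at h2
  ext
  · exact sub_eq_zero.1 (pow_eq_zero_iff two_ne_zero |>.1 h3)
  · exact sub_eq_zero.1 (norm_eq_zero.1 (pow_eq_zero_iff two_ne_zero |>.1 h2))

theorem sq_form_sub_le (x y z : Hyperboloid E) :
    (form x z - form x y * form y z) ^ 2 ≤ (form x y ^ 2 - 1) * (form y z ^ 2 - 1) := by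
  have hx := x.form_eq_one
  have hy := y.form_eq_one
  have hz := z.form_eq_one
  set P := form x y with hP
  set Q := form y z with hQ
  set N := form x z with hN
  simp only [form] at hP hQ hN
  have key : ∀ r : ℝ, 0 ≤ (Q ^ 2 - 1) * (r * r) + (2 * (P * Q - N)) * r + (P ^ 2 - 1) := by
    intro r
    have h := sq_le_of_orthogonal y
      (x.time - P * y.time + r * (z.time - Q * y.time))
      (x.space - P • y.space + r • (z.space - Q • y.space)) (by
        simp only [inner_add_left, inner_sub_left, real_inner_smul_left,
          real_inner_self_eq_norm_sq]
        rw [real_inner_comm z.space y.space] at *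
        linear_combination (-P - r * Q) * hy - hP - r * hQ)
    rw [← real_inner_self_eq_norm_sq] at h
    simp only [inner_add_left, inner_sub_left, inner_add_right, inner_sub_right,
      real_inner_smul_left, real_inner_smul_right] at h
    simp only [real_inner_self_eq_norm_sq] at h
    rw [real_inner_comm x.space y.space, real_inner_comm y.space z.space,
      real_inner_comm x.space z.space] at h
    have e1 : inner ℝ x.space y.space = x.time * y.time - P := by linarith
    have e2 : inner ℝ y.space z.space = y.time * z.time - Q := by linarith
    have e3 : inner ℝ x.space z.space = x.time * z.time - N := by linarith
    have e4 : ‖x.space‖ ^ 2 = x.time ^ 2 - 1 := by linarith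
    have e5 : ‖y.space‖ ^ 2 = y.time ^ 2 - 1 := by linarith
    have e6 : ‖z.space‖ ^ 2 = z.time ^ 2 - 1 := by linarith
    rw [e1, e2, e3, e4, e5, e6] at h
    linarith
  have hd := discrim_le_zero key
  unfold discrim at hd
  nlinarith

instance instMetricSpace : MetricSpace (Hyperboloid E) where
  dist x y := Real.arcosh (form x y)
  dist_self x := by
    rw [form_self]
    exact (Real.arcosh_eq_zero_iff le_rfl).2 rfl
  dist_comm x y := by
    rw [form_comm]
  dist_triangle x y z := by
    have hP := one_le_form x y
    have hQ := one_le_form y z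
    have hN := one_le_form x z
    have h0 : 0 ≤ Real.arcosh (form x y) + Real.arcosh (form y z) :=
      add_nonneg (Real.arcosh_nonneg hP) (Real.arcosh_nonneg hQ)
    rw [← Real.arcosh_cosh h0, Real.arcosh_le_arcosh (by linarith) (Real.cosh_pos _),
      Real.cosh_add, Real.cosh_arcosh hP, Real.cosh_arcosh hQ, Real.sinh_arcosh hP,
      Real.sinh_arcosh hQ, ← Real.sqrt_mul (by nlinarith)]
    have := Real.le_sqrt_of_sq_le (sq_form_sub_le x y z)
    linarith
  eq_of_dist_eq_zero := by
    intro x y h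
    exact eq_of_form_eq_one x y ((Real.arcosh_eq_zero_iff (one_le_form x y)).1 h)

end Hyperboloid

/-- The real algebraic hyperbolic space `H^κ`, for a cardinal `κ`: the hyperboloid model over the
Hilbert space `ℓ²(κ)` of dimension `κ`, with the distance given by `cosh d(x, y) = ⟨x, y⟩`. -/
abbrev AlgHyperbolicSpace (κ : Cardinal.{u}) : Type u :=
  Hyperboloid (lp (fun _ : κ.out => ℝ) 2)

end Hyperboloid

/-! ## Abstract and algebraic cross-ratios -/

section CrossRatio

variable {Y : Type*}

/-- At least three of the four points are distinct. -/
def AtLeastThreeDistinct (a b c d : Y) : Prop :=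
  (a ≠ b ∧ a ≠ c ∧ b ≠ c) ∨ (a ≠ b ∧ a ≠ d ∧ b ≠ d) ∨
    (a ≠ c ∧ a ≠ d ∧ c ≠ d) ∨ (b ≠ c ∧ b ≠ d ∧ c ≠ d)

variable (Y) in
/-- The set `Y⁽⁴⁾ ⊆ Y⁴` of quadruples of which at least three are distinct. -/
def quadruples : Set (Y × Y × Y × Y) :=
  {q | AtLeastThreeDistinct q.1 q.2.1 q.2.2.1 q.2.2.2}

/-- A kernel of conditionally negative type. -/
structure IsCondNegType {Z : Type*} (K : Z → Z → ℝ) : Prop where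
  symm : ∀ x y, K x y = K y x
  diag : ∀ x, K x x = 0
  nonpos : ∀ (n : ℕ) (x : Fin n → Z) (l : Fin n → ℝ), ∑ i, l i = 0 →
    ∑ i, ∑ j, l i * l j * K (x i) (x j) ≤ 0

/-- Abstract cross-ratios. Only the values of `B` on `Y⁽⁴⁾` matter. The cocycle relation is required
whenever its right-hand side is not an indeterminate product `0 * ∞`. -/
structure IsAbstractCrossRatio [TopologicalSpace Y] (B : Y → Y → Y → Y → ℝ≥0∞) : Prop where
  continuousOn :
    ContinuousOn (fun q : Y × Y × Y × Y => B q.1 q.2.1 q.2.2.1 q.2.2.2) (quadruples Y)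
  exchange : ∀ x x' y y', AtLeastThreeDistinct x x' y y' → B x x' y y' = B y y' x x'
  reverse : ∀ x x' y y', AtLeastThreeDistinct x x' y y' → B x x' y y' = B x' x y' y
  inversion_left : ∀ x x' y y', AtLeastThreeDistinct x x' y y' → B x x' y y' = (B y x' x y')⁻¹
  inversion_right : ∀ x x' y y', AtLeastThreeDistinct x x' y y' → B x x' y y' = (B x y' y x')⁻¹
  cocycle : ∀ x y x' y' x'', AtLeastThreeDistinct x y x' y' → AtLeastThreeDistinct x y x'' y' →
    AtLeastThreeDistinct x'' y x' y' →
    (B x y x'' y' ≠ 0 ∨ B x'' y x' y' ≠ ∞) → (B x y x'' y' ≠ ∞ ∨ B x'' y x' y' ≠ 0) →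
    B x y x' y' = B x y x'' y' * B x'' y x' y'
  eq_zero_iff : ∀ x x' y y', AtLeastThreeDistinct x x' y y' →
    (B x x' y y' = 0 ↔ x = x' ∨ y = y')
  eq_top_iff : ∀ x x' y y', AtLeastThreeDistinct x x' y y' →
    (B x x' y y' = ∞ ↔ x = y' ∨ y = x')

open Classical in
/-- The kernel `(x, y) ↦ (R(x, y, p, w) R(y, p, q, w))²` on `Y \ {w}` attached to a triple
`(p, q, w)` of distinct points, playing the role of `(0, 1, ∞)`; it is `0` on the diagonal, and where
`y = p ≠ x` the indeterminate product `R(x, p, p, w) R(p, p, q, w) = ∞ * 0` is read as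
`R(x, p, q, w)`. All values of `R` involved are finite. -/
def crossRatioKernel (R : Y → Y → Y → Y → ℝ≥0∞) (p q w : Y) (x y : {y : Y // y ≠ w}) : ℝ :=
  if x = y then 0
  else if (y : Y) = p then (R x p q w).toReal ^ 2
  else (R x y p w * R y p q w).toReal ^ 2

/-- Algebraic cross-ratios. -/
structure IsAlgebraicCrossRatio [TopologicalSpace Y] (R : Y → Y → Y → Y → ℝ≥0∞) : Prop
    extends IsAbstractCrossRatio R where
  condNegType : ∀ p q w : Y, p ≠ q → p ≠ w → q ≠ w → IsCondNegType (crossRatioKernel R p q w)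

/-- `f : Y → ∂H^κ` is continuous with total image, and the boundary cross-ratio of `H^κ` pulls back
to `R` under `f`. -/
structure RealizesCrossRatio [TopologicalSpace Y] (R : Y → Y → Y → Y → ℝ≥0∞)
    (κ : Cardinal.{u}) (f : Y → GromovBoundary (AlgHyperbolicSpace κ)) : Prop where
  continuous : Continuous f
  total : IsTotalBoundarySet (Set.range f)
  crossRatio_eq : ∀ (o : AlgHyperbolicSpace κ) (a b c d : Y), AtLeastThreeDistinct a b c d →
    boundaryCrossRatio o (f a) (f b) (f c) (f d) = R a b c d

end CrossRatio

end

/-! A boundary point of the hyperboloid is an isotropic ray of the Minkowski space `ℝ × E`,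
represented by `light ζ = (1, dir ζ)` with `dir ζ` a unit vector. The limit of `exp (-2 (x | y)_o)`
at two boundary points is a Minkowski product of their light vectors divided by one factor for each
point (`tendsto_exp_gromovProduct`). These factors cancel in cross-ratios, so the boundary
cross-ratio is that of the chordal metric on the unit sphere (`boundaryCrossRatio_eq`). Geodesic
lines lie in planes spanned by their isotropic ends, and totality of a boundary set amounts to
density of the linear span of its light vectors (`isTotal_of_dense_span`, `dense_span_of_isTotal`).

Existence: a point `w` of `Y` is placed at infinity. The cocycle relation writes `R` as the
cross-ratio of a distance `δ` equal to `1` between `w` and the other points (`eq_weights`). Off `w`,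
the algebraic condition says that `δ²` is conditionally of negative type, hence equal to `‖g x - g
y‖²` for a map `g` to a Hilbert space (`IsCondNegType.exists_hilbert`). Lifting `g` to a paraboloid
in the light cone gives isotropic vectors with products `2 δ²` (`exists_isotropic`).

Uniqueness: if two maps realize `R`, the quotient of their chordal distances satisfies a four-cycle
identity, hence is a product `μ x * μ y` (`exists_mul_of_four_cycle`). After rescaling, the two
families of light vectors have the same Gram matrix. A timelike vector chosen in the same way on
both sides splits off a negative definite complement, on which equality of Gram matrices gives a
Hilbert isometry (`exists_minkowskiEquiv`). Any distance-preserving map scales products with light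
vectors; three points determine the scales, and total families determine the map
(`isometry_eq_of_boundaryMap_eq`). This uniqueness makes the isometries attached to a group action a
homomorphism. -/

noncomputable section

/-! ## The Minkowski space `ℝ × E` -/

section Minkowski

set_option linter.unusedSectionVars false

variable {E : Type*} [NormedAddCommGroup E] [InnerProductSpace ℝ E]

/-- The Minkowski bilinear form on `ℝ × E`. -/
def mink : (ℝ × E) →ₗ[ℝ] (ℝ × E) →ₗ[ℝ] ℝ :=
  LinearMap.mk₂ ℝ (fun v w => v.1 * w.1 - inner ℝ v.2 w.2)
    (fun v v' w => by simp [inner_add_left]; ring)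
    (fun c v w => by simp [real_inner_smul_left]; ring)
    (fun v w w' => by simp [inner_add_right]; ring)
    (fun c v w => by simp [real_inner_smul_right]; ring)

theorem mink_apply (v w : ℝ × E) : mink v w = v.1 * w.1 - inner ℝ v.2 w.2 := rfl

attribute [irreducible] mink

theorem mink_comm (v w : ℝ × E) : mink v w = mink w v := by
  simp only [mink_apply]
  rw [mul_comm, real_inner_comm]

theorem continuous_mink : Continuous fun p : (ℝ × E) × (ℝ × E) => mink p.1 p.2 := by
  simp only [mink_apply]
  fun_prop

theorem Filter.Tendsto.mink {α : Type*} {l : Filter α} {f g : α → ℝ × E} {v w : ℝ × E}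
    (hf : Tendsto f l (𝓝 v)) (hg : Tendsto g l (𝓝 w)) :
    Tendsto (fun n => mink (f n) (g n)) l (𝓝 (mink v w)) :=
  (continuous_mink.tendsto (v, w)).comp (hf.prodMk_nhds hg)

theorem mink_light_light {ξ η : E} (hξ : ‖ξ‖ = 1) (hη : ‖η‖ = 1) :
    mink ((1, ξ) : ℝ × E) (1, η) = dist ξ η ^ 2 / 2 := by
  rw [mink_apply, dist_eq_norm, norm_sub_sq_real, hξ, hη]
  ring

/-- A vector orthogonal to the whole Minkowski space vanishes. -/
theorem eq_zero_of_mink_eq_zero {v : ℝ × E} (h : ∀ w, mink v w = 0) : v = 0 := by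
  have h1 := h (1, 0)
  have h2 := h (0, v.2)
  simp [mink_apply] at h1 h2
  ext <;> simp [h1, h2]

/-- The orthogonal of `v` is a closed subspace, so a total family tests whether `v` vanishes. This
is how a point is recovered from its products with light vectors. -/
theorem eq_zero_of_mink_eq_zero_of_dense {v : ℝ × E} {s : Set (ℝ × E)}
    (hs : (Submodule.span ℝ s).topologicalClosure = ⊤) (h : ∀ w ∈ s, mink v w = 0) : v = 0 := by
  refine eq_zero_of_mink_eq_zero fun w => ?_
  have hw : w ∈ closure (Submodule.span ℝ s : Set (ℝ × E)) := by
    rw [← Submodule.topologicalClosure_coe, hs]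
    trivial
  have hc : IsClosed {w : ℝ × E | mink v w = 0} :=
    isClosed_eq (continuous_mink.comp (Continuous.prodMk_right v)) continuous_const
  refine hc.closure_subset_iff.2 (fun x hx => ?_) hw
  have : Submodule.span ℝ s ≤ LinearMap.ker (mink v) := Submodule.span_le.2 fun y hy => h y hy
  exact this hx

namespace Hyperboloid

/-- A point of the hyperboloid as a vector of the Minkowski space. -/
def vec (x : Hyperboloid E) : ℝ × E := (x.time, x.space)

theorem vec_injective : Function.Injective (vec : Hyperboloid E → ℝ × E) := by
  intro x y h
  simp only [vec, Prod.mk.injEq] at h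
  exact Hyperboloid.ext h.1 h.2

theorem form_eq_mink (x y : Hyperboloid E) : form x y = mink x.vec y.vec := by
  rw [mink_apply]
  rfl

theorem mink_vec_self (x : Hyperboloid E) : mink x.vec x.vec = 1 := by
  rw [← form_eq_mink, form_self]

/-- The point of the hyperboloid over a vector of the open future cone. -/
def normalize (v : ℝ × E) (h0 : 0 < v.1) (h : 0 < mink v v) : Hyperboloid E where
  time := (√(mink v v))⁻¹ * v.1
  space := (√(mink v v))⁻¹ • v.2
  time_pos := by positivity
  form_eq_one := by
    have h1 : √(mink v v) ^ 2 = mink v v := Real.sq_sqrt h.le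
    have h2 : √(mink v v) ≠ 0 := (Real.sqrt_pos.2 h).ne'
    rw [norm_smul, mul_pow, mul_pow, norm_inv, inv_pow, inv_pow, Real.norm_eq_abs, sq_abs, h1]
    have h3 : v.1 ^ 2 - ‖v.2‖ ^ 2 = mink v v := by
      rw [mink_apply, real_inner_self_eq_norm_sq]; ring
    rw [← mul_sub, h3, inv_mul_cancel₀ h.ne']

theorem vec_normalize (v : ℝ × E) (h0 : 0 < v.1) (h : 0 < mink v v) :
    (normalize v h0 h).vec = (√(mink v v))⁻¹ • v := rfl

/-- The origin of the hyperboloid. -/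
def origin : Hyperboloid E := ⟨1, 0, one_pos, by simp⟩

theorem norm_space_lt (x : Hyperboloid E) : ‖x.space‖ < x.time := by
  have := x.form_eq_one
  exact lt_of_pow_lt_pow_left₀ 2 x.time_pos.le (by linarith)

theorem mink_vec_light_pos (x : Hyperboloid E) {ξ : E} (hξ : ‖ξ‖ = 1) :
    0 < mink x.vec (1, ξ) := by
  have h := real_inner_le_norm x.space ξ
  have := norm_space_lt x
  rw [hξ] at h
  simp only [mink_apply, vec]
  linarith

theorem cosh_dist (x y : Hyperboloid E) : Real.cosh (dist x y) = form x y :=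
  Real.cosh_arcosh (one_le_form x y)

/-- Since `2 cosh d = exp d + exp (-d)`, the exponential of the distance is twice the form up to a
bounded error, which disappears at infinity after division by the times. -/
theorem exp_dist (x y : Hyperboloid E) :
    Real.exp (dist x y) = 2 * form x y - Real.exp (-dist x y) := by
  rw [← cosh_dist, Real.cosh_eq]
  ring

theorem exp_dist_le (x y : Hyperboloid E) : Real.exp (dist x y) ≤ 2 * form x y := by
  rw [exp_dist]
  linarith [Real.exp_pos (-dist x y)]

theorem form_le_exp_dist (x y : Hyperboloid E) : form x y ≤ Real.exp (dist x y) := by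
  have : Real.exp (-dist x y) ≤ Real.exp (dist x y) :=
    Real.exp_le_exp.2 (by linarith [dist_nonneg (x := x) (y := y)])
  rw [← cosh_dist, Real.cosh_eq]
  linarith

theorem isometry_iff_form {F : Type*} [NormedAddCommGroup F] [InnerProductSpace ℝ F]
    {φ : Hyperboloid E → Hyperboloid F} :
    Isometry φ ↔ ∀ x y, form (φ x) (φ y) = form x y := by
  refine ⟨fun h x y => ?_, fun h => Isometry.of_dist_eq fun x y => ?_⟩
  · rw [← cosh_dist, ← cosh_dist, h.dist_eq]
  · change Real.arcosh _ = Real.arcosh _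
    rw [h]

theorem exp_neg_gromovProduct (o x y : Hyperboloid E) :
    Real.exp (-(2 * gromovProduct o x y)) =
      Real.exp (dist x y) / (Real.exp (dist o x) * Real.exp (dist o y)) := by
  rw [← Real.exp_add, ← Real.exp_sub]
  congr 1
  unfold gromovProduct
  ring

theorem form_origin (x : Hyperboloid E) : form origin x = x.time := by
  simp [form, origin]

/-- The projection of the hyperboloid to the open unit ball. -/
def klein (x : Hyperboloid E) : E := x.time⁻¹ • x.space

theorem smul_vec_eq (x : Hyperboloid E) : x.time⁻¹ • x.vec = (1, klein x) := by
  ext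
  · simp [vec, x.time_pos.ne']
  · rfl

theorem norm_klein_sq (x : Hyperboloid E) : ‖klein x‖ ^ 2 = 1 - (x.time ^ 2)⁻¹ := by
  have h := x.form_eq_one
  have h0 := x.time_pos.ne'
  rw [klein, norm_smul, mul_pow, norm_inv, inv_pow, Real.norm_eq_abs, sq_abs]
  field_simp
  linarith

theorem mink_klein (x y : Hyperboloid E) :
    mink ((1, klein x) : ℝ × E) (1, klein y) = form x y / (x.time * y.time) := by
  rw [← smul_vec_eq, ← smul_vec_eq, form_eq_mink]
  simp only [map_smul, LinearMap.smul_apply, smul_eq_mul]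
  have h0 := x.time_pos.ne'
  have h1 := y.time_pos.ne'
  field_simp

/-- Both Klein points have norm at most `1`, so the squared distance is at most `2 - 2 ⟪·, ·⟫`,
twice the product of the vectors rescaled to time `1`. Bounding the form by `exp d` and each `exp
(dist origin ·)` by twice the time gives `8 = 2 * 2 * 2`. Large Gromov products thus force Klein
points together. -/
theorem dist_klein_sq_le (x y : Hyperboloid E) :
    dist (klein x) (klein y) ^ 2 ≤ 8 * Real.exp (-(2 * gromovProduct origin x y)) := by
  have h0 := x.time_pos
  have h1 := y.time_pos
  have hx : ‖klein x‖ ^ 2 ≤ 1 := by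
    rw [norm_klein_sq]
    have : 0 < (x.time ^ 2)⁻¹ := by positivity
    linarith
  have hy : ‖klein y‖ ^ 2 ≤ 1 := by
    rw [norm_klein_sq]
    have : 0 < (y.time ^ 2)⁻¹ := by positivity
    linarith
  have h2 : dist (klein x) (klein y) ^ 2 ≤ 2 * (form x y / (x.time * y.time)) := by
    rw [← mink_klein, mink_apply, dist_eq_norm, norm_sub_sq_real]
    linarith
  refine h2.trans ?_
  rw [exp_neg_gromovProduct]
  have e1 := exp_dist_le origin x
  have e2 := exp_dist_le origin y
  rw [form_origin] at e1 e2
  have e3 := form_le_exp_dist x y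
  have : Real.exp (dist origin x) * Real.exp (dist origin y) ≤ 2 * x.time * (2 * y.time) := by
    gcongr
  calc 2 * (form x y / (x.time * y.time)) ≤ 2 * (Real.exp (dist x y) / (x.time * y.time)) := by
        gcongr
    _ = 8 * (Real.exp (dist x y) / (2 * x.time * (2 * y.time))) := by field_simp; norm_num
    _ ≤ _ := by gcongr

end Hyperboloid

end Minkowski

end

noncomputable section

/-! ## The Gromov boundary of the hyperboloid is the unit sphere -/

section Boundary

set_option linter.unusedSectionVars false

variable {E : Type*} [NormedAddCommGroup E] [InnerProductSpace ℝ E]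

namespace Hyperboloid

theorem _root_.tendsto_fst_atTop : Tendsto (Prod.fst : ℕ × ℕ → ℕ) atTop atTop := by
  rw [← prod_atTop_atTop_eq]
  exact tendsto_fst

theorem _root_.tendsto_snd_atTop : Tendsto (Prod.snd : ℕ × ℕ → ℕ) atTop atTop := by
  rw [← prod_atTop_atTop_eq]
  exact tendsto_snd

theorem norm_eq_one_of_tendsto_klein {α : Type*} {l : Filter α} [l.NeBot]
    {s : α → Hyperboloid E} {ξ : E}
    (hs : Tendsto (fun n => (s n).time) l atTop) (hξ : Tendsto (fun n => klein (s n)) l (𝓝 ξ)) :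
    ‖ξ‖ = 1 := by
  have h1 : Tendsto (fun n => ‖klein (s n)‖ ^ 2) l (𝓝 (‖ξ‖ ^ 2)) := (hξ.norm).pow 2
  have h2 : Tendsto (fun n => ‖klein (s n)‖ ^ 2) l (𝓝 (1 - 0)) := by
    simp only [norm_klein_sq]
    exact tendsto_const_nhds.sub
      (tendsto_inv_atTop_zero.comp ((tendsto_pow_atTop two_ne_zero).comp hs))
  have := tendsto_nhds_unique h1 h2
  rw [sub_zero] at this
  exact (pow_eq_one_iff_of_nonneg (norm_nonneg _) two_ne_zero).1 this

/-- Continuous extension of the Gromov product to the boundary. After division by the times, the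
forms become products of the convergent vectors `(1, klein ·)`. Exponentiating keeps the case `ξ =
η` inside the statement: the limit is then `0`. -/
theorem tendsto_exp_gromovProduct {α : Type*} {l : Filter α} [l.NeBot]
    {s t : α → Hyperboloid E} {ξ η : E}
    (hs : Tendsto (fun n => (s n).time) l atTop) (hξ : Tendsto (fun n => klein (s n)) l (𝓝 ξ))
    (ht : Tendsto (fun n => (t n).time) l atTop) (hη : Tendsto (fun n => klein (t n)) l (𝓝 η))
    (o : Hyperboloid E) :
    Tendsto (fun n => Real.exp (-(2 * gromovProduct o (s n) (t n)))) l
      (𝓝 (mink ((1, ξ) : ℝ × E) (1, η) / (2 * mink o.vec (1, ξ) * mink o.vec (1, η)))) := by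
  have hξ1 := norm_eq_one_of_tendsto_klein hs hξ
  have hη1 := norm_eq_one_of_tendsto_klein ht hη
  have hx := mink_vec_light_pos o hξ1
  have hy := mink_vec_light_pos o hη1
  have hsi : Tendsto (fun n => (s n).time⁻¹) l (𝓝 0) := tendsto_inv_atTop_zero.comp hs
  have hti : Tendsto (fun n => (t n).time⁻¹) l (𝓝 0) := tendsto_inv_atTop_zero.comp ht
  have bdd : ∀ x y : α → Hyperboloid E, IsBoundedUnder (· ≤ ·) l
      (fun n => ‖Real.exp (-dist (x n) (y n))‖) := fun x y =>
    isBoundedUnder_of ⟨1, fun n => by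
      rw [Real.norm_eq_abs, Real.abs_exp]
      exact Real.exp_le_one_iff.2 (by linarith [dist_nonneg (x := x n) (y := y n)])⟩
  -- The errors `exp (-dist)` are at most `1`, and are multiplied by inverse times, which tend to
  -- `0`.
  have e0 : Tendsto (fun n => (s n).time⁻¹ * (t n).time⁻¹ * Real.exp (-dist (s n) (t n))) l
      (𝓝 0) := by
    refine Tendsto.zero_mul_isBoundedUnder_le ?_ (bdd s t)
    simpa using hsi.mul hti
  have e1 : Tendsto (fun n => (s n).time⁻¹ * Real.exp (-dist o (s n))) l (𝓝 0) :=
    Tendsto.zero_mul_isBoundedUnder_le hsi (bdd (fun _ => o) s)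
  have e2 : Tendsto (fun n => (t n).time⁻¹ * Real.exp (-dist o (t n))) l (𝓝 0) :=
    Tendsto.zero_mul_isBoundedUnder_le hti (bdd (fun _ => o) t)
  have l0 := (tendsto_const_nhds (x := (1 : ℝ)).prodMk_nhds hξ).mink
    (tendsto_const_nhds (x := (1 : ℝ)).prodMk_nhds hη)
  have l1 := (tendsto_const_nhds (x := o.vec)).mink
    (tendsto_const_nhds (x := (1 : ℝ)).prodMk_nhds hξ)
  have l2 := (tendsto_const_nhds (x := o.vec)).mink
    (tendsto_const_nhds (x := (1 : ℝ)).prodMk_nhds hη)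
  have key := ((l0.const_mul 2).sub e0).div
    (((l1.const_mul 2).sub e1).mul ((l2.const_mul 2).sub e2)) (by simp; exact ⟨hx.ne', hy.ne'⟩)
  have hlim : (2 * mink ((1, ξ) : ℝ × E) (1, η) - 0) /
      ((2 * mink o.vec (1, ξ) - 0) * (2 * mink o.vec (1, η) - 0)) =
      mink ((1, ξ) : ℝ × E) (1, η) / (2 * mink o.vec (1, ξ) * mink o.vec (1, η)) := by
    have := hx.ne'
    have := hy.ne'
    field_simp
    ring
  rw [hlim] at key
  refine key.congr fun n => ?_
  have hs0 := (s n).time_pos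
  have ht0 := (t n).time_pos
  rw [exp_neg_gromovProduct, exp_dist, exp_dist o, exp_dist o]
  have m1 : mink o.vec (1, klein (s n)) = form o (s n) / (s n).time := by
    rw [← smul_vec_eq, map_smul, form_eq_mink, smul_eq_mul, inv_mul_eq_div]
  have m2 : mink o.vec (1, klein (t n)) = form o (t n) / (t n).time := by
    rw [← smul_vec_eq, map_smul, form_eq_mink, smul_eq_mul, inv_mul_eq_div]
  simp only [Pi.div_apply]
  rw [mink_klein, m1, m2]
  have q1 : 0 < 2 * form o (s n) - Real.exp (-dist o (s n)) := by
    rw [← exp_dist]; exact Real.exp_pos _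
  have q2 : 0 < 2 * form o (t n) - Real.exp (-dist o (t n)) := by
    rw [← exp_dist]; exact Real.exp_pos _
  have r1 : 2 * (form o (s n) / (s n).time) - (s n).time⁻¹ * Real.exp (-dist o (s n)) =
      (2 * form o (s n) - Real.exp (-dist o (s n))) / (s n).time := by field_simp
  have r2 : 2 * (form o (t n) / (t n).time) - (t n).time⁻¹ * Real.exp (-dist o (t n)) =
      (2 * form o (t n) - Real.exp (-dist o (t n))) / (t n).time := by field_simp
  rw [r1, r2]
  field_simp

theorem tendsto_gromovProduct_atTop_iff {α : Type*} {l : Filter α} {s t : α → Hyperboloid E}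
    {o : Hyperboloid E} :
    Tendsto (fun n => gromovProduct o (s n) (t n)) l atTop ↔
      Tendsto (fun n => Real.exp (-(2 * gromovProduct o (s n) (t n)))) l (𝓝 0) := by
  rw [Real.tendsto_exp_comp_nhds_zero, tendsto_neg_atBot_iff,
    tendsto_const_mul_atTop_of_pos two_pos]

theorem tendsto_time_of_convergesToInfinity {s : ℕ → Hyperboloid E}
    (hs : ConvergesToInfinity s) : Tendsto (fun n => (s n).time) atTop atTop := by
  have h : Tendsto (fun n => dist origin (s n)) atTop atTop := by
    -- On the diagonal the Gromov product of a point with itself is its distance to the base point.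
    refine ((hs origin).comp tendsto_atTop_diagonal).congr fun n => ?_
    simp [gromovProduct]
  have h1 := Real.tendsto_exp_atTop.comp h
  refine tendsto_atTop_mono (fun n => ?_) (h1.const_mul_atTop (r := 2⁻¹) (by norm_num))
  have := exp_dist_le origin (s n)
  rw [form_origin] at this
  simp only [Function.comp]
  linarith

theorem exists_tendsto_klein [CompleteSpace E] {s : ℕ → Hyperboloid E}
    (hs : ConvergesToInfinity s) : ∃ ξ, Tendsto (fun n => klein (s n)) atTop (𝓝 ξ) := by
  refine cauchySeq_tendsto_of_complete ?_
  rw [cauchySeq_iff_tendsto_dist_atTop_0]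
  have h1 := (tendsto_gromovProduct_atTop_iff.1 (hs origin)).const_mul 8
  rw [mul_zero] at h1
  have h2 := squeeze_zero (fun p : ℕ × ℕ => sq_nonneg (dist (klein (s p.1)) (klein (s p.2))))
    (fun p => dist_klein_sq_le _ _) h1
  have h3 := h2.sqrt
  simpa [Real.sqrt_sq dist_nonneg] using h3

theorem tendsto_gromovProduct_of_klein {s t : ℕ → Hyperboloid E} {ξ : E}
    (hs : Tendsto (fun n => (s n).time) atTop atTop)
    (hξ : Tendsto (fun n => klein (s n)) atTop (𝓝 ξ))
    (ht : Tendsto (fun n => (t n).time) atTop atTop)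
    (hη : Tendsto (fun n => klein (t n)) atTop (𝓝 ξ)) (o : Hyperboloid E) :
    Tendsto (fun p : ℕ × ℕ => gromovProduct o (s p.1) (t p.2)) atTop atTop := by
  rw [tendsto_gromovProduct_atTop_iff]
  have f1 : Tendsto (Prod.fst : ℕ × ℕ → ℕ) atTop atTop := tendsto_fst_atTop
  have f2 : Tendsto (Prod.snd : ℕ × ℕ → ℕ) atTop atTop := tendsto_snd_atTop
  have h := tendsto_exp_gromovProduct (hs.comp f1) (hξ.comp f1) (ht.comp f2) (hη.comp f2) o
  have h1 := norm_eq_one_of_tendsto_klein hs hξ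
  rw [mink_light_light h1 h1] at h
  simpa using h

theorem convergesToInfinity_of_klein {s : ℕ → Hyperboloid E} {ξ : E}
    (hs : Tendsto (fun n => (s n).time) atTop atTop)
    (hξ : Tendsto (fun n => klein (s n)) atTop (𝓝 ξ)) : ConvergesToInfinity s :=
  fun o => tendsto_gromovProduct_of_klein hs hξ hs hξ o

variable [CompleteSpace E]

/-- The limit in the unit sphere of a sequence converging to infinity. -/
def seqDir (s : InfinitySeq (Hyperboloid E)) : E := (exists_tendsto_klein s.2).choose

theorem tendsto_seqDir (s : InfinitySeq (Hyperboloid E)) :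
    Tendsto (fun n => klein (s.1 n)) atTop (𝓝 (seqDir s)) := (exists_tendsto_klein s.2).choose_spec

/-- One direction is the estimate `dist_klein_sq_le` at the limit; in the other, `exp (-2 (s m | t
n))` tends to a multiple of the product of equal light vectors, which is `0`. Hence the relation is
an equivalence and its classes embed in the unit sphere. -/
theorem equivalent_iff (s t : InfinitySeq (Hyperboloid E)) :
    InfinitySeq.Equivalent s t ↔ seqDir s = seqDir t := by
  refine ⟨fun h => ?_, fun h o => ?_⟩
  · have h1 := (tendsto_gromovProduct_atTop_iff.1 (h origin)).const_mul 8
    rw [mul_zero] at h1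
    have h2 := squeeze_zero (fun p : ℕ × ℕ => sq_nonneg (dist (klein (s.1 p.1)) (klein (t.1 p.2))))
      (fun p => dist_klein_sq_le _ _) h1
    have h3 : Tendsto (fun p : ℕ × ℕ => dist (klein (s.1 p.1)) (klein (t.1 p.2)) ^ 2) atTop
        (𝓝 (dist (seqDir s) (seqDir t) ^ 2)) :=
      (((tendsto_seqDir s).comp tendsto_fst_atTop).dist
        ((tendsto_seqDir t).comp tendsto_snd_atTop)).pow 2
    have := tendsto_nhds_unique h3 h2
    exact dist_eq_zero.1 (pow_eq_zero_iff two_ne_zero |>.1 this)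
  · exact tendsto_gromovProduct_of_klein (tendsto_time_of_convergesToInfinity s.2)
      (tendsto_seqDir s) (tendsto_time_of_convergesToInfinity t.2) (h ▸ tendsto_seqDir t) o

end Hyperboloid

open Hyperboloid

namespace GromovBoundary

variable [CompleteSpace E]

/-- The unit vector which represents a boundary point of the hyperboloid. -/
def dir : GromovBoundary (Hyperboloid E) → E :=
  Quot.lift seqDir fun s t h => (equivalent_iff s t).1 h

theorem exists_limit_eq (ζ : GromovBoundary (Hyperboloid E)) :
    ∃ s : InfinitySeq (Hyperboloid E), s.limit = ζ := by
  induction ζ using Quot.ind with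
  | mk s => exact ⟨s, rfl⟩

theorem dir_injective : Function.Injective (dir : GromovBoundary (Hyperboloid E) → E) := by
  intro ξ η h
  obtain ⟨s, rfl⟩ := exists_limit_eq ξ
  obtain ⟨t, rfl⟩ := exists_limit_eq η
  exact Quot.sound ((equivalent_iff s t).2 h)

theorem norm_dir (ζ : GromovBoundary (Hyperboloid E)) : ‖dir ζ‖ = 1 := by
  obtain ⟨s, rfl⟩ := exists_limit_eq ζ
  exact norm_eq_one_of_tendsto_klein (tendsto_time_of_convergesToInfinity s.2) (tendsto_seqDir s)

theorem tendsto_klein {s : InfinitySeq (Hyperboloid E)} {ζ : GromovBoundary (Hyperboloid E)}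
    (h : s.limit = ζ) : Tendsto (fun n => klein (s.1 n)) atTop (𝓝 (dir ζ)) := by
  subst h
  exact tendsto_seqDir s

theorem convergesToBoundary_iff {s : ℕ → Hyperboloid E} {ζ : GromovBoundary (Hyperboloid E)} :
    ConvergesToBoundary s ζ ↔ Tendsto (fun n => (s n).time) atTop atTop ∧
      Tendsto (fun n => klein (s n)) atTop (𝓝 (dir ζ)) := by
  refine ⟨?_, fun ⟨h1, h2⟩ => ⟨convergesToInfinity_of_klein h1 h2, ?_⟩⟩
  · rintro ⟨h, rfl⟩
    exact ⟨tendsto_time_of_convergesToInfinity h, tendsto_seqDir ⟨s, h⟩⟩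
  · refine dir_injective (tendsto_nhds_unique ?_ h2)
    exact tendsto_klein rfl

theorem exists_dir_eq {ξ : E} (hξ : ‖ξ‖ = 1) :
    ∃ ζ : GromovBoundary (Hyperboloid E), dir ζ = ξ := by
  -- Points of the geodesic ray from the origin towards `ξ`; their Klein projections are `tanh n •
  -- ξ`.
  let s : ℕ → Hyperboloid E := fun n =>
    ⟨Real.cosh n, Real.sinh n • ξ, Real.cosh_pos _, by
      rw [norm_smul, hξ, mul_one, Real.norm_eq_abs, sq_abs, Real.cosh_sq]; ring⟩
  have h1 : Tendsto (fun n => (s n).time) atTop atTop := by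
    refine tendsto_atTop_mono (f := fun n : ℕ => 2⁻¹ * Real.exp n) (fun n => ?_)
      ((Real.tendsto_exp_atTop.comp tendsto_natCast_atTop_atTop).const_mul_atTop
        (r := 2⁻¹) (by norm_num))
    simp only [s, Real.cosh_eq]
    linarith [Real.exp_pos (-(n : ℝ))]
  have h2 : Tendsto (fun n => klein (s n)) atTop (𝓝 ξ) := by
    have e1 : Tendsto (fun n : ℕ => Real.exp (-(2 * (n : ℝ)))) atTop (𝓝 0) := by
      rw [Real.tendsto_exp_comp_nhds_zero, tendsto_neg_atBot_iff,
        tendsto_const_mul_atTop_of_pos two_pos]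
      exact tendsto_natCast_atTop_atTop
    have e2 := ((e1.const_sub 1).div (e1.const_add 1) (by norm_num)).smul_const ξ
    simp only [sub_zero, add_zero, div_one, one_smul] at e2
    refine e2.congr fun n => ?_
    simp only [klein, s, smul_smul, Pi.div_apply]
    congr 1
    rw [Real.cosh_eq, Real.sinh_eq]
    have h3 : Real.exp (-(2 * (n : ℝ))) = Real.exp (-(n : ℝ)) / Real.exp n := by
      rw [← Real.exp_sub]; congr 1; ring
    rw [h3]
    have := Real.exp_pos n
    have := Real.exp_pos (-(n : ℝ))
    field_simp
  refine ⟨InfinitySeq.limit ⟨s, convergesToInfinity_of_klein h1 h2⟩, ?_⟩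
  exact tendsto_nhds_unique (tendsto_klein rfl) h2

/-- The isotropic vector which represents a boundary point of the hyperboloid. -/
def light (ζ : GromovBoundary (Hyperboloid E)) : ℝ × E := (1, dir ζ)

theorem mink_light (ξ η : GromovBoundary (Hyperboloid E)) :
    mink (light ξ) (light η) = dist (dir ξ) (dir η) ^ 2 / 2 :=
  mink_light_light (norm_dir ξ) (norm_dir η)

theorem mink_vec_light (o : Hyperboloid E) (ζ : GromovBoundary (Hyperboloid E)) :
    0 < mink o.vec (light ζ) := mink_vec_light_pos o (norm_dir ζ)

/-- The infimum and the lower limit in the definition are harmless: the limit exists and is the same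
for all sequences. The square root undoes the factor `2` in `exp (-2 (ξ | η))`. -/
theorem visualDist_eq (o : Hyperboloid E) (ξ η : GromovBoundary (Hyperboloid E)) :
    visualDist o ξ η = ENNReal.ofReal
      (√(mink (light ξ) (light η) / (2 * mink o.vec (light ξ) * mink o.vec (light η)))) := by
  set D := mink (light ξ) (light η) / (2 * mink o.vec (light ξ) * mink o.vec (light η)) with hD
  have key : ∀ s t : InfinitySeq (Hyperboloid E), s.limit = ξ → t.limit = η →
      Tendsto (fun p : ℕ × ℕ => Real.exp (-(2 * gromovProduct o (s.1 p.1) (t.1 p.2)))) atTop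
        (𝓝 D) := by
    intro s t hs ht
    have f1 : Tendsto (Prod.fst : ℕ × ℕ → ℕ) atTop atTop := tendsto_fst_atTop
    have f2 : Tendsto (Prod.snd : ℕ × ℕ → ℕ) atTop atTop := tendsto_snd_atTop
    exact tendsto_exp_gromovProduct ((tendsto_time_of_convergesToInfinity s.2).comp f1)
      ((tendsto_klein hs).comp f1) ((tendsto_time_of_convergesToInfinity t.2).comp f2)
      ((tendsto_klein ht).comp f2) o
  have hD0 : 0 ≤ D := by
    have h1 := mink_vec_light o ξ
    have h2 := mink_vec_light o η
    rw [hD, mink_light]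
    positivity
  obtain ⟨s₀, hs₀⟩ := exists_limit_eq ξ
  obtain ⟨t₀, ht₀⟩ := exists_limit_eq η
  have const : ∀ L : ℝ≥0∞, (∀ s t : InfinitySeq (Hyperboloid E), s.limit = ξ → t.limit = η →
      Tendsto (fun p : ℕ × ℕ => ENNReal.ofReal (gromovProduct o (s.1 p.1) (t.1 p.2))) atTop
        (𝓝 L)) → boundaryGromovProduct o ξ η = L := by
    intro L hL
    refine le_antisymm ?_ ?_
    · refine (iInf_le_of_le s₀ <| iInf_le_of_le t₀ <| iInf_le_of_le hs₀ <| iInf_le _ ht₀).trans ?_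
      exact (hL s₀ t₀ hs₀ ht₀).liminf_eq.le
    · refine le_iInf fun s => le_iInf fun t => le_iInf fun hs => le_iInf fun ht => ?_
      exact (hL s t hs ht).liminf_eq.ge
  unfold visualDist
  -- The limit `D` vanishes exactly when the Gromov product is infinite; otherwise the product is
  -- `-(log D) / 2`.
  rcases hD0.eq_or_lt with h0 | h0
  · rw [const ⊤ fun s t hs ht => ENNReal.tendsto_ofReal_nhds_top.2
      (tendsto_gromovProduct_atTop_iff.2 (h0 ▸ key s t hs ht)), ← h0]
    simp
  · have hL : ∀ s t : InfinitySeq (Hyperboloid E), s.limit = ξ → t.limit = η →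
        Tendsto (fun p : ℕ × ℕ => gromovProduct o (s.1 p.1) (t.1 p.2)) atTop
          (𝓝 (-(Real.log D / 2))) := by
      intro s t hs ht
      have := (((Real.continuousAt_log h0.ne').tendsto.comp (key s t hs ht)).div_const 2).neg
      refine this.congr fun p => ?_
      simp only [Function.comp, Real.log_exp]
      ring
    have h1 : 0 ≤ -(Real.log D / 2) := by
      refine ge_of_tendsto' (hL s₀ t₀ hs₀ ht₀) fun p => ?_
      have := dist_triangle_left (s₀.1 p.1) (t₀.1 p.2) o
      unfold gromovProduct
      linarith
    rw [const _ fun s t hs ht => ENNReal.tendsto_ofReal (hL s t hs ht)]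
    rw [EReal.coe_ennreal_ofReal, max_eq_left h1, ← EReal.coe_neg, EReal.exp_coe, neg_neg,
      Real.sqrt_eq_rpow, Real.rpow_def_of_pos h0]
    congr 2
    ring

/-- Cross-ratios do not change if a distance is rescaled at each point. -/
theorem crossRatio_rescale {Z : Type*} {e δ : Z → Z → ℝ≥0∞} {k : Z → ℝ≥0∞}
    (h : ∀ x y, e x y = δ x y * k x * k y) (h0 : ∀ x, k x ≠ 0) (ht : ∀ x, k x ≠ ∞) (a b c d : Z) :
    (e a b * e c d) / (e a d * e c b) = (δ a b * δ c d) / (δ a d * δ c b) := by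
  simp only [h]
  have e1 : δ a b * k a * k b * (δ c d * k c * k d) =
    δ a b * δ c d * (k a * k b * k c * k d) := by ring
  have e2 : δ a d * k a * k d * (δ c b * k c * k b) =
    δ a d * δ c b * (k a * k b * k c * k d) := by ring
  rw [e1, e2]
  refine ENNReal.mul_div_mul_right _ _ ?_ ?_
  · simp only [ne_eq, mul_eq_zero, h0, or_self, not_false_eq_true]
  · exact ENNReal.mul_ne_top (ENNReal.mul_ne_top (ENNReal.mul_ne_top (ht _) (ht _)) (ht _)) (ht _)

/-- The visual distance is the chordal distance times a factor `(2 ⟨o, light ξ⟩)^(-1/2)` at each of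
the two points, and such factors cancel. The right-hand side no longer contains `o`. -/
theorem boundaryCrossRatio_eq (o : Hyperboloid E) (a b c d : GromovBoundary (Hyperboloid E)) :
    boundaryCrossRatio o a b c d = (edist (dir a) (dir b) * edist (dir c) (dir d)) /
      (edist (dir a) (dir d) * edist (dir c) (dir b)) := by
  let k : GromovBoundary (Hyperboloid E) → ℝ := fun ξ => (√(2 * mink o.vec (light ξ)))⁻¹
  have hk : ∀ ξ, 0 < k ξ := fun ξ => by
    have := mink_vec_light o ξ
    simp only [k]
    positivity
  have h : ∀ ξ η, visualDist o ξ η =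
      edist (dir ξ) (dir η) * ENNReal.ofReal (k ξ) * ENNReal.ofReal (k η) := by
    intro ξ η
    have h1 := mink_vec_light o ξ
    have h2 := mink_vec_light o η
    rw [visualDist_eq, edist_dist, ← ENNReal.ofReal_mul dist_nonneg,
      ← ENNReal.ofReal_mul (mul_nonneg dist_nonneg (hk ξ).le), mink_light]
    congr 1
    simp only [k]
    rw [← Real.sqrt_inv, ← Real.sqrt_inv]
    nth_rw 2 [← Real.sqrt_sq (dist_nonneg (x := dir ξ) (y := dir η))]
    rw [← Real.sqrt_mul (by positivity), ← Real.sqrt_mul (by positivity)]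
    congr 1
    field_simp
  exact crossRatio_rescale h (fun ξ => (ENNReal.ofReal_pos.2 (hk ξ)).ne')
    (fun ξ => ENNReal.ofReal_ne_top) a b c d

/-- A map to the boundary is continuous if the corresponding map to the unit sphere is. -/
theorem continuous_of_continuous_dir {Y : Type*} [TopologicalSpace Y]
    {f : Y → GromovBoundary (Hyperboloid E)} (hf : Continuous fun y => dir (f y)) :
    Continuous f := by
  refine continuous_def.2 fun U hU => isOpen_iff_mem_nhds.2 fun y hy => ?_
  obtain ⟨r, hr, h⟩ := hU (f y) hy origin
  have h0 : Tendsto (fun z => visualDist origin (f y) (f z)) (𝓝 y) (𝓝 0) := by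
    have h1 : ∀ z, visualDist origin (f y) (f z) =
        ENNReal.ofReal (√(dist (dir (f y)) (dir (f z)) ^ 2 / 4)) := by
      intro z
      -- Seen from the origin all light vectors have product `1`, so the visual distance is half the
      -- chord.
      have e : ∀ ζ : GromovBoundary (Hyperboloid E), mink origin.vec (light ζ) = 1 := fun ζ => by
        simp [mink_apply, vec, origin, light]
      rw [visualDist_eq, mink_light, e, e]
      congr 2
      ring
    simp only [h1]
    have h2 : Continuous fun z => ENNReal.ofReal (√(dist (dir (f y)) (dir (f z)) ^ 2 / 4)) :=
      ENNReal.continuous_ofReal.comp (by fun_prop)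
    have := h2.tendsto y
    simpa using this
  have hpos : (0 : ℝ≥0∞) < EReal.exp (-(r : EReal)) := by
    rw [EReal.zero_lt_exp_iff, bot_lt_iff_ne_bot, ne_eq, EReal.neg_eq_bot_iff]
    simpa using hr.ne
  filter_upwards [h0.eventually_lt_const hpos] with z hz
  refine h _ ?_
  unfold visualDist at hz
  rw [EReal.exp_lt_exp_iff, EReal.neg_lt_neg_iff] at hz
  exact EReal.coe_ennreal_lt_coe_ennreal_iff.1 hz

end GromovBoundary

end Boundary

end

noncomputable section

/-! ## Totally geodesic subspaces and linear spans -/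

section Total

set_option linter.unusedSectionVars false

variable {E : Type*} [NormedAddCommGroup E] [InnerProductSpace ℝ E]

/-- The open future cone of the Minkowski space. -/
def futureCone (E : Type*) [NormedAddCommGroup E] [InnerProductSpace ℝ E] : Set (ℝ × E) :=
  {v | 0 < v.1 ∧ 0 < mink v v}

theorem isOpen_futureCone : IsOpen (futureCone E) := by
  have h : Continuous fun v : ℝ × E => mink v v :=
    continuous_mink.comp (by fun_prop : Continuous fun v : ℝ × E => (v, v))
  exact (isOpen_lt continuous_const continuous_fst).inter (isOpen_lt continuous_const h)

namespace Hyperboloid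

theorem vec_mem_futureCone (x : Hyperboloid E) : x.vec ∈ futureCone E :=
  ⟨x.time_pos, by rw [mink_vec_self]; exact one_pos⟩

theorem smul_vec_mem_futureCone {t : ℝ} (ht : 0 < t) (x : Hyperboloid E) :
    t • x.vec ∈ futureCone E := by
  refine ⟨mul_pos ht x.time_pos, ?_⟩
  simp only [map_smul, LinearMap.smul_apply, smul_eq_mul, mink_vec_self]
  positivity

theorem eq_smul_normalize {v : ℝ × E} (hv : v ∈ futureCone E) :
    v = √(mink v v) • (normalize v hv.1 hv.2).vec := by
  rw [vec_normalize, smul_smul, mul_inv_cancel₀ (Real.sqrt_pos.2 hv.2).ne', one_smul]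

/-- Reverse Cauchy-Schwarz: both vectors are positive multiples of points, whose form is at least
`1`. -/
theorem mink_pos_of_mem_futureCone {v w : ℝ × E} (hv : v ∈ futureCone E) (hw : w ∈ futureCone E) :
    0 < mink v w := by
  have h1 := Real.sqrt_pos.2 hv.2
  have h2 := Real.sqrt_pos.2 hw.2
  have h3 := one_le_form (normalize v hv.1 hv.2) (normalize w hw.1 hw.2)
  rw [eq_smul_normalize hv, eq_smul_normalize hw]
  simp only [map_smul, LinearMap.smul_apply, smul_eq_mul, ← form_eq_mink]
  positivity

theorem add_mem_futureCone {v w : ℝ × E} (hv : v ∈ futureCone E) (hw : w ∈ futureCone E) :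
    v + w ∈ futureCone E := by
  refine ⟨add_pos hv.1 hw.1, ?_⟩
  simp only [map_add, LinearMap.add_apply]
  have h1 := mink_pos_of_mem_futureCone hv hw
  have h2 := mink_pos_of_mem_futureCone hw hv
  have := hv.2
  have := hw.2
  linarith

/-- The point of the hyperboloid given by a vector. -/
def ofVec (v : ℝ × E) (h0 : 0 < v.1) (h : mink v v = 1) : Hyperboloid E where
  time := v.1
  space := v.2
  time_pos := h0
  form_eq_one := by
    rw [← h, mink_apply, real_inner_self_eq_norm_sq]
    ring

theorem vec_ofVec (v : ℝ × E) (h0 : 0 < v.1) (h : mink v v = 1) : (ofVec v h0 h).vec = v := rfl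

/-- With `|sinh r| < cosh r`, this bound on unit tangent vectors keeps `cosh r • x + sinh r • e` on
the upper sheet. -/
theorem sq_fst_lt_of_orthogonal {x : Hyperboloid E} {e : ℝ × E} (hx : mink x.vec e = 0)
    (he : mink e e = -1) : e.1 ^ 2 < x.time ^ 2 := by
  have h1 := sq_mul_le_of_orthogonal x e.1 e.2 (by
    rw [mink_apply] at hx
    rw [real_inner_comm]
    simp only [vec] at hx
    linarith)
  rw [mink_apply, real_inner_self_eq_norm_sq] at he
  have h2 := x.form_eq_one
  nlinarith

theorem abs_sinh_lt_cosh (r : ℝ) : |Real.sinh r| < Real.cosh r := by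
  refine abs_lt.2 ⟨?_, Real.sinh_lt_cosh r⟩
  rw [Real.sinh_eq, Real.cosh_eq]
  linarith [Real.exp_pos r, Real.exp_pos (-r)]

/-- The geodesic issued from `x` with unit velocity `e`. -/
def geodesic (x : Hyperboloid E) (e : ℝ × E) (hx : mink x.vec e = 0) (he : mink e e = -1) (r : ℝ) :
    Hyperboloid E :=
  ofVec (Real.cosh r • x.vec + Real.sinh r • e)
    (by
      have h1 := abs_lt_of_sq_lt_sq (sq_fst_lt_of_orthogonal hx he) x.time_pos.le
      have h2 := abs_sinh_lt_cosh r
      have h3 : |Real.sinh r * e.1| < Real.cosh r * x.time := by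
        rw [abs_mul]
        exact mul_lt_mul'' h2 h1 (abs_nonneg _) (abs_nonneg _)
      have := neg_lt_of_abs_lt h3
      simp only [Prod.fst_add, Prod.smul_fst, smul_eq_mul, vec]
      linarith)
    (by
      simp only [map_add, map_smul, LinearMap.add_apply, LinearMap.smul_apply, smul_eq_mul,
        mink_vec_self, he, hx, mink_comm e x.vec]
      linear_combination Real.cosh_sq r)

theorem vec_geodesic {x : Hyperboloid E} {e : ℝ × E} (hx : mink x.vec e = 0) (he : mink e e = -1)
    (r : ℝ) : (geodesic x e hx he r).vec = Real.cosh r • x.vec + Real.sinh r • e := rfl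

theorem dist_eq_abs_of_form_eq {x y : Hyperboloid E} {r : ℝ} (h : form x y = Real.cosh r) :
    dist x y = |r| := by
  change Real.arcosh _ = _
  rw [h, ← Real.cosh_abs, Real.arcosh_cosh (abs_nonneg r)]

theorem isometry_geodesic {x : Hyperboloid E} {e : ℝ × E} (hx : mink x.vec e = 0)
    (he : mink e e = -1) : Isometry (geodesic x e hx he) := by
  refine Isometry.of_dist_eq fun r s => ?_
  rw [Real.dist_eq]
  refine dist_eq_abs_of_form_eq ?_
  rw [form_eq_mink, vec_geodesic, vec_geodesic, Real.cosh_sub]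
  simp only [map_add, map_smul, LinearMap.add_apply, LinearMap.smul_apply, smul_eq_mul,
    mink_vec_self, he, hx, mink_comm e x.vec]
  ring

theorem form_isometry {γ : ℝ → Hyperboloid E} (hγ : Isometry γ) (r s : ℝ) :
    mink (γ r).vec (γ s).vec = Real.cosh (r - s) := by
  rw [← form_eq_mink, ← cosh_dist, hγ.dist_eq, Real.dist_eq, Real.cosh_abs]

theorem eq_zero_of_orthogonal {x : Hyperboloid E} {v : ℝ × E} (hx : mink x.vec v = 0)
    (hv : mink v v = 0) : v = 0 := by
  rw [mink_apply, real_inner_self_eq_norm_sq] at hv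
  have h1 := sq_mul_le_of_orthogonal x v.1 v.2 (by
    rw [mink_apply] at hx
    rw [real_inner_comm]
    simp only [vec] at hx
    linarith)
  have h2 : ‖v.2‖ ^ 2 = v.1 ^ 2 := by linarith
  rw [h2] at h1
  have h3 : v.1 ^ 2 = 0 := le_antisymm (by linarith) (sq_nonneg _)
  rw [h3] at h2
  ext
  · exact pow_eq_zero_iff two_ne_zero |>.1 h3
  · exact norm_eq_zero.1 (pow_eq_zero_iff two_ne_zero |>.1 h2)

/-- Geodesic lines lie in planes. -/
theorem sinh_smul_geodesic {γ : ℝ → Hyperboloid E} (hγ : Isometry γ) (a b r : ℝ) :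
    Real.sinh (b - a) • (γ r).vec =
      Real.sinh (b - r) • (γ a).vec + Real.sinh (r - a) • (γ b).vec := by
  rw [← sub_eq_zero]
  set w := Real.sinh (b - a) • (γ r).vec -
    (Real.sinh (b - r) • (γ a).vec + Real.sinh (r - a) • (γ b).vec) with hw
  -- By the addition formulas `w` is orthogonal to every point of the line. As a combination of such
  -- points it is also isotropic, and the form is definite on the orthogonal of `γ 0`.
  have key : ∀ t, mink (γ t).vec w = 0 := by
    intro t
    simp only [hw, map_sub, map_add, map_smul, smul_eq_mul, form_isometry hγ]
    have e1 := Real.sinh_sub (t - a) (t - b)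
    have e2 := Real.sinh_sub (t - r) (t - b)
    have e3 := Real.sinh_sub (t - a) (t - r)
    rw [sub_sub_sub_cancel_left] at e1 e2 e3
    rw [e1, e2, e3]
    ring
  refine eq_zero_of_orthogonal (key 0) ?_
  nth_rw 1 [hw]
  simp only [map_sub, map_add, map_smul, LinearMap.sub_apply, LinearMap.add_apply,
    LinearMap.smul_apply, key]
  simp

theorem continuous_vec : Continuous (vec : Hyperboloid E → ℝ × E) := by
  have ht : Continuous (fun x : Hyperboloid E => x.time) := by
    have : (fun x : Hyperboloid E => x.time) = fun x => Real.cosh (dist origin x) := by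
      ext x
      rw [cosh_dist, form_origin]
    rw [this]
    exact Real.continuous_cosh.comp (continuous_const.dist continuous_id)
  refine ht.prodMk (continuous_iff_continuousAt.2 fun x => ?_)
  -- The Minkowski square of `y - x` is `2 - 2 cosh d`, which expresses the space difference through
  -- the time difference and the distance.
  have h : ∀ y : Hyperboloid E, ‖y.space - x.space‖ ^ 2 =
      (y.time - x.time) ^ 2 + 2 * (Real.cosh (dist y x) - 1) := by
    intro y
    have h1 := x.form_eq_one
    have h2 := y.form_eq_one
    rw [norm_sub_sq_real, cosh_dist, form]
    linear_combination -h1 - h2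
  have hc : Continuous fun y : Hyperboloid E =>
      √((y.time - x.time) ^ 2 + 2 * (Real.cosh (dist y x) - 1)) := by
    have : Continuous fun y : Hyperboloid E => Real.cosh (dist y x) :=
      Real.continuous_cosh.comp (continuous_id.dist continuous_const)
    fun_prop
  refine tendsto_iff_norm_sub_tendsto_zero.2 ?_
  have := hc.tendsto x
  simp only [sub_self, dist_self, Real.cosh_zero, mul_zero, ne_eq, OfNat.ofNat_ne_zero,
    not_false_eq_true, zero_pow, add_zero, Real.sqrt_zero] at this
  refine this.congr fun y => ?_
  rw [← h, Real.sqrt_sq (norm_nonneg _)]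

theorem tendsto_of_tendsto_vec {α : Type*} {l : Filter α} {s : α → Hyperboloid E}
    {x : Hyperboloid E} (h : Tendsto (fun n => (s n).vec) l (𝓝 x.vec)) : Tendsto s l (𝓝 x) := by
  rw [tendsto_iff_dist_tendsto_zero]
  -- `arcosh` is used as a function continuous on `[1, ∞)`, so the limit is taken within that set.
  have h1 : Tendsto (fun n => form (s n) x) l (𝓝[Set.Ici 1] 1) := by
    refine tendsto_nhdsWithin_iff.2 ⟨?_, Eventually.of_forall fun n => one_le_form _ _⟩
    rw [← mink_vec_self x]
    simp only [form_eq_mink]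
    exact h.mink (tendsto_const_nhds (x := x.vec))
  have h2 := (Real.continuousOn_arcosh 1 Set.self_mem_Ici).tendsto.comp h1
  rw [Real.arcosh_zero] at h2
  exact h2

/-- Completeness under planes of a totally geodesic subspace. -/
theorem normalize_mem_of_isTotallyGeodesic {S : Set (Hyperboloid E)} (hS : IsTotallyGeodesic S)
    {x y : Hyperboloid E} (hx : x ∈ S) (hy : y ∈ S) {a b : ℝ}
    (hv : a • x.vec + b • y.vec ∈ futureCone E) :
    normalize (a • x.vec + b • y.vec) hv.1 hv.2 ∈ S := by
  rcases eq_or_ne x y with rfl | hxy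
  · have h0 : a • x.vec + b • x.vec = (a + b) • x.vec := (add_smul _ _ _).symm
    have h1 : 0 < a + b := by
      have := hv.1
      rw [h0] at this
      exact pos_of_mul_pos_left this x.time_pos.le
    have h2 : mink ((a + b) • x.vec) ((a + b) • x.vec) = (a + b) ^ 2 := by
      simp only [map_smul, LinearMap.smul_apply, smul_eq_mul, mink_vec_self]
      ring
    have : normalize _ hv.1 hv.2 = x := by
      refine vec_injective ?_
      rw [vec_normalize, h0, h2, Real.sqrt_sq h1.le, smul_smul, inv_mul_cancel₀ h1.ne', one_smul]
    rwa [this]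
  · set N := form x y with hN
    have hN1 : 1 < N := (one_le_form x y).lt_of_ne fun h => hxy (eq_of_form_eq_one x y h.symm)
    have hxy' : mink x.vec y.vec = N := (form_eq_mink x y).symm
    have hyx' : mink y.vec x.vec = N := by rw [mink_comm, hxy']
    have hs2 : 0 < N ^ 2 - 1 := by nlinarith
    set s := √(N ^ 2 - 1) with hs
    have hs0 : 0 < s := Real.sqrt_pos.2 hs2
    have hss : s ^ 2 = N ^ 2 - 1 := Real.sq_sqrt hs2.le
    -- The unit tangent vector at `x` pointing to `y`: here `N` and `s` are `cosh` and `sinh` of the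
    -- distance, and `y = N • x + s • e`.
    set e : ℝ × E := s⁻¹ • (y.vec - N • x.vec) with he
    have hxe : mink x.vec e = 0 := by
      simp [he, hxy', mink_vec_self]
    have hee : mink e e = -1 := by
      simp only [he, map_smul, map_sub, LinearMap.smul_apply, LinearMap.sub_apply, smul_eq_mul,
        mink_vec_self, hxy', hyx']
      field_simp
      linear_combination hss
    have hye : y.vec = N • x.vec + s • e := by
      rw [he, smul_smul, mul_inv_cancel₀ hs0.ne', one_smul, add_sub_cancel]
    set v := a • x.vec + b • y.vec with hvdef
    have hv1 : v = (a + b * N) • x.vec + (b * s) • e := by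
      rw [hvdef, hye]
      module
    have hq : mink v v = (a + b * N) ^ 2 - (b * s) ^ 2 := by
      rw [hv1]
      simp only [map_add, map_smul, LinearMap.add_apply, LinearMap.smul_apply, smul_eq_mul,
        mink_vec_self, hxe, hee, mink_comm e x.vec]
      ring
    have ha : 0 < a + b * N := by
      have := mink_pos_of_mem_futureCone x.vec_mem_futureCone hv
      rw [hv1] at this
      simpa [mink_vec_self, hxe] using this
    set q := mink v v with hqdef
    have hq0 : 0 < √q := Real.sqrt_pos.2 hv.2
    have hqq : √q ^ 2 = q := Real.sq_sqrt hv.2.le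
    let γ := geodesic x e hxe hee
    have hγ : Isometry γ := isometry_geodesic hxe hee
    have h0 : γ 0 = x := vec_injective (by simp [γ, vec_geodesic])
    have h1 : γ (Real.arcosh N) = y := vec_injective (by
      simp only [γ, vec_geodesic, Real.cosh_arcosh hN1.le, Real.sinh_arcosh hN1.le]
      exact hye.symm)
    -- Since `q = (a + b N)² - (b s)²` and `a + b N > 0`, the normalized vector is `cosh r • x +
    -- sinh r • e` with `sinh r = b s / √q`.
    have h2 : γ (Real.arsinh (b * s / √q)) = normalize v hv.1 hv.2 := vec_injective (by
      rw [vec_normalize, vec_geodesic, Real.sinh_arsinh, Real.cosh_arsinh, ← hqdef]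
      have : 1 + (b * s / √q) ^ 2 = ((a + b * N) / √q) ^ 2 := by
        field_simp
        linear_combination hqq + hq
      rw [this, Real.sqrt_sq (by positivity)]
      rw [hv1]
      module)
    rw [← h2]
    exact hS γ hγ 0 (Real.arcosh N) (Real.arcosh_pos hN1).ne (h0 ▸ hx) (h1 ▸ hy) _

/-- The cone over a set of points of the hyperboloid. -/
def coneOver (S : Set (Hyperboloid E)) : Set (ℝ × E) := {v | ∃ x ∈ S, ∃ t : ℝ, 0 < t ∧ v = t • x.vec}

theorem coneOver_subset_futureCone (S : Set (Hyperboloid E)) : coneOver S ⊆ futureCone E := by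
  rintro _ ⟨x, -, t, ht, rfl⟩
  exact smul_vec_mem_futureCone ht x

theorem mem_coneOver_of_combination {S : Set (Hyperboloid E)} (hS : IsTotallyGeodesic S)
    {v w : ℝ × E} (hv : v ∈ coneOver S) (hw : w ∈ coneOver S) {a b : ℝ}
    (h : a • v + b • w ∈ futureCone E) : a • v + b • w ∈ coneOver S := by
  obtain ⟨x, hx, t, ht, rfl⟩ := hv
  obtain ⟨y, hy, r, hr, rfl⟩ := hw
  rw [smul_smul, smul_smul] at h ⊢
  exact ⟨_, normalize_mem_of_isTotallyGeodesic hS hx hy h, _, Real.sqrt_pos.2 h.2,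
    eq_smul_normalize h⟩

/-- The cone over `S` is stable under sums and positive multiples, so every element of the span is a
difference of two of its elements. If such a difference is timelike and future, the planar case
applies to it. -/
theorem mem_coneOver_of_mem_span {S : Set (Hyperboloid E)} (hS : IsTotallyGeodesic S)
    {v : ℝ × E} (hv : v ∈ Submodule.span ℝ (vec '' S)) (h : v ∈ futureCone E) :
    v ∈ coneOver S := by
  rcases S.eq_empty_or_nonempty with rfl | ⟨x₀, hx₀⟩
  · simp only [Set.image_empty, Submodule.span_empty, Submodule.mem_bot] at hv
    subst hv
    exact absurd h.1 (lt_irrefl _)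
  have hadd : ∀ c ∈ coneOver S, ∀ d ∈ coneOver S, c + d ∈ coneOver S := by
    intro c hc d hd
    have := mem_coneOver_of_combination hS hc hd (a := 1) (b := 1)
    simp only [one_smul] at this
    exact this (add_mem_futureCone (coneOver_subset_futureCone S hc)
      (coneOver_subset_futureCone S hd))
  have hsmul : ∀ r : ℝ, 0 < r → ∀ c ∈ coneOver S, r • c ∈ coneOver S := by
    rintro r hr _ ⟨x, hx, t, ht, rfl⟩
    exact ⟨x, hx, r * t, mul_pos hr ht, smul_smul _ _ _⟩
  have h₀ : x₀.vec ∈ coneOver S := ⟨x₀, hx₀, 1, one_pos, (one_smul _ _).symm⟩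
  have key : ∀ v ∈ Submodule.span ℝ (vec '' S), ∃ c ∈ coneOver S, ∃ d ∈ coneOver S, v = c - d := by
    intro v hv
    induction hv using Submodule.span_induction with
    | mem v hv =>
      obtain ⟨x, hx, rfl⟩ := hv
      have h₁ : x.vec ∈ coneOver S := ⟨x, hx, 1, one_pos, (one_smul _ _).symm⟩
      exact ⟨_, hadd _ h₁ _ h₁, _, h₁, by abel⟩
    | zero => exact ⟨_, h₀, _, h₀, (sub_self _).symm⟩
    | add v w _ _ hv hw =>
      obtain ⟨c, hc, d, hd, rfl⟩ := hv
      obtain ⟨c', hc', d', hd', rfl⟩ := hw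
      exact ⟨_, hadd _ hc _ hc', _, hadd _ hd _ hd', by abel⟩
    | smul r v _ hv =>
      obtain ⟨c, hc, d, hd, rfl⟩ := hv
      rcases lt_trichotomy r 0 with hr | rfl | hr
      · exact ⟨_, hsmul (-r) (by linarith) _ hd, _, hsmul (-r) (by linarith) _ hc, by module⟩
      · exact ⟨_, h₀, _, h₀, by simp⟩
      · exact ⟨_, hsmul r hr _ hc, _, hsmul r hr _ hd, smul_sub _ _ _⟩
  obtain ⟨c, hc, d, hd, rfl⟩ := key v hv
  have := mem_coneOver_of_combination hS hc hd (a := 1) (b := -1)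
  simp only [one_smul, neg_smul, ← sub_eq_add_neg] at this
  exact this h

/-- The future cone is open, so vectors of the span approximating `x.vec` eventually lie in it;
normalized, they are points of `S` converging to `x`. -/
theorem eq_univ_of_dense_span {S : Set (Hyperboloid E)} (hS : IsTotallyGeodesic S)
    (hc : IsClosed S) (h : (Submodule.span ℝ (vec '' S)).topologicalClosure = ⊤) :
    S = Set.univ := by
  refine Set.eq_univ_of_forall fun x => ?_
  have hx : x.vec ∈ closure (Submodule.span ℝ (vec '' S) : Set (ℝ × E)) := by
    rw [← Submodule.topologicalClosure_coe, h]
    trivial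
  obtain ⟨v, hv, hvx⟩ := mem_closure_iff_seq_limit.1 hx
  have hev : ∀ᶠ n in atTop, v n ∈ futureCone E :=
    hvx.eventually (isOpen_futureCone.mem_nhds x.vec_mem_futureCone)
  -- For the finitely many `n` with `v n` possibly outside the cone, `y` is an arbitrary point.
  have hex : ∀ n, ∃ y : Hyperboloid E, v n ∈ futureCone E →
      y ∈ S ∧ y.vec = (√(mink (v n) (v n)))⁻¹ • v n := by
    intro n
    by_cases hn : v n ∈ futureCone E
    · obtain ⟨y, hy, t, ht, e⟩ := mem_coneOver_of_mem_span hS (hv n) hn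
      refine ⟨y, fun _ => ⟨hy, ?_⟩⟩
      have : mink (v n) (v n) = t ^ 2 := by
        rw [e]
        simp only [map_smul, LinearMap.smul_apply, smul_eq_mul, mink_vec_self]
        ring
      rw [this, Real.sqrt_sq ht.le, e, smul_smul, inv_mul_cancel₀ ht.ne', one_smul]
    · exact ⟨x, fun h => absurd h hn⟩
  choose y hy using hex
  have hlim : Tendsto (fun n => (√(mink (v n) (v n)))⁻¹ • v n) atTop (𝓝 x.vec) := by
    have h1 := (hvx.mink hvx).sqrt.inv₀ (by simp [mink_vec_self])
    rw [mink_vec_self, Real.sqrt_one, inv_one] at h1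
    simpa using h1.smul hvx
  refine hc.mem_of_tendsto (tendsto_of_tendsto_vec (s := y) (hlim.congr' ?_)) ?_
  · filter_upwards [hev] with n hn using (hy n hn).2.symm
  · filter_upwards [hev] with n hn using (hy n hn).1

theorem isTotallyGeodesic_preimage (W : Submodule ℝ (ℝ × E)) :
    IsTotallyGeodesic {x : Hyperboloid E | x.vec ∈ W} := by
  intro γ hγ a b hab ha hb r
  have h := sinh_smul_geodesic hγ a b r
  have h0 : Real.sinh (b - a) ≠ 0 := by
    rw [ne_eq, Real.sinh_eq_zero, sub_eq_zero]
    exact hab.symm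
  have h1 : Real.sinh (b - a) • (γ r).vec ∈ W := by
    rw [h]
    exact W.add_mem (W.smul_mem _ ha) (W.smul_mem _ hb)
  exact (W.smul_mem_iff h0).1 h1

theorem span_range_vec : Submodule.span ℝ (Set.range (vec : Hyperboloid E → ℝ × E)) = ⊤ := by
  refine eq_top_iff.2 fun v _ => ?_
  have h0 : ((1, 0) : ℝ × E) ∈ Submodule.span ℝ (Set.range (vec : Hyperboloid E → ℝ × E)) :=
    Submodule.subset_span ⟨origin, rfl⟩
  have h1 : ((√(1 + ‖v.2‖ ^ 2), v.2) : ℝ × E) ∈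
      Submodule.span ℝ (Set.range (vec : Hyperboloid E → ℝ × E)) :=
    Submodule.subset_span ⟨⟨√(1 + ‖v.2‖ ^ 2), v.2, by positivity, by
      rw [Real.sq_sqrt (by positivity)]; ring⟩, rfl⟩
  have : v = ((√(1 + ‖v.2‖ ^ 2), v.2) : ℝ × E) + (v.1 - √(1 + ‖v.2‖ ^ 2)) • (1, 0) := by
    ext <;> simp
  rw [this]
  exact Submodule.add_mem _ h1 (Submodule.smul_mem _ _ h0)

end Hyperboloid

open Hyperboloid

namespace GromovBoundary

variable [CompleteSpace E]

/-- Projective criterion for convergence: a scale tending to `0` with nonzero limiting time forces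
the times to infinity, and the ratio of the components yields the Klein limit. -/
theorem convergesToBoundary_of_smul {s : ℕ → Hyperboloid E} {ζ : GromovBoundary (Hyperboloid E)}
    {c : ℕ → ℝ} (hc0 : ∀ n, 0 < c n) (hc : Tendsto c atTop (𝓝 0)) {t : ℝ} (ht : 0 < t)
    (h : Tendsto (fun n => c n • (s n).vec) atTop (𝓝 (t • light ζ))) : ConvergesToBoundary s ζ := by
  have h1 : Tendsto (fun n => c n * (s n).time) atTop (𝓝 t) := by
    have := (continuous_fst.tendsto _).comp h
    simpa [light, vec, Function.comp_def] using this
  have h2 : Tendsto (fun n => c n • (s n).space) atTop (𝓝 (t • dir ζ)) :=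
    (continuous_snd.tendsto _).comp h
  rw [convergesToBoundary_iff]
  constructor
  · have h3 : Tendsto (fun n => (c n)⁻¹) atTop atTop :=
      tendsto_inv_nhdsGT_zero.comp (tendsto_nhdsWithin_iff.2 ⟨hc, Eventually.of_forall hc0⟩)
    refine (h3.atTop_mul_pos ht h1).congr fun n => ?_
    rw [inv_mul_cancel_left₀ (hc0 n).ne']
  · have := (h1.inv₀ ht.ne').smul h2
    rw [smul_smul, inv_mul_cancel₀ ht.ne', one_smul] at this
    refine this.congr fun n => ?_
    have := (hc0 n).ne'
    have := (s n).time_pos.ne'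
    rw [klein, smul_smul]
    congr 1
    field_simp

theorem ConvergesToBoundary.tendsto_smul {s : ℕ → Hyperboloid E}
    {ζ : GromovBoundary (Hyperboloid E)} (h : ConvergesToBoundary s ζ) :
    Tendsto (fun n => (s n).time⁻¹) atTop (𝓝 0) ∧
      Tendsto (fun n => (s n).time⁻¹ • (s n).vec) atTop (𝓝 (light ζ)) := by
  obtain ⟨h1, h2⟩ := convergesToBoundary_iff.1 h
  refine ⟨tendsto_inv_atTop_zero.comp h1, ?_⟩
  simp only [smul_vec_eq]
  exact tendsto_const_nhds.prodMk_nhds h2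

theorem mink_light_self (ζ : GromovBoundary (Hyperboloid E)) : mink (light ζ) (light ζ) = 0 := by
  simp [mink_light]

theorem mink_light_pos {ξ η : GromovBoundary (Hyperboloid E)} (h : ξ ≠ η) :
    0 < mink (light ξ) (light η) := by
  rw [mink_light]
  have : 0 < dist (dir ξ) (dir η) := dist_pos.2 fun h' => h (dir_injective h')
  positivity

/-- The geodesic line between two boundary points. -/
theorem exists_geodesicLine {ξ η : GromovBoundary (Hyperboloid E)} (h : ξ ≠ η) :
    ∃ γ : ℝ → Hyperboloid E, IsGeodesicLine γ ξ η ∧ ∀ r, (γ r).vec =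
      (√(2 * mink (light ξ) (light η)))⁻¹ •
        (Real.exp r • light η + Real.exp (-r) • light ξ) := by
  have hm := mink_light_pos h
  set m := mink (light ξ) (light η) with hmdef
  have hm' : mink (light η) (light ξ) = m := by rw [mink_comm]
  -- The sum and the difference of the two light vectors have Minkowski squares `2 m` and `-2 m`.
  -- Division by `k` gives a point and a unit tangent vector there.
  set k := √(2 * m) with hk
  have hk0 : 0 < k := Real.sqrt_pos.2 (by positivity)
  have hkk : k ^ 2 = 2 * m := Real.sq_sqrt (by positivity)
  have h1 : mink (k⁻¹ • (light η + light ξ)) (k⁻¹ • (light η + light ξ)) = 1 := by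
    simp only [map_smul, map_add, LinearMap.smul_apply, LinearMap.add_apply, smul_eq_mul,
      mink_light_self, hm', ← hmdef]
    field_simp
    linear_combination -hkk
  let x : Hyperboloid E := ofVec (k⁻¹ • (light η + light ξ))
    (mul_pos (inv_pos.2 hk0) (by simp [light])) h1
  have hx : mink x.vec (k⁻¹ • (light η - light ξ)) = 0 := by
    simp only [x, vec_ofVec, map_smul, map_add, map_sub, LinearMap.smul_apply, LinearMap.add_apply,
      smul_eq_mul, mink_light_self, hm', ← hmdef]
    ring
  have he : mink (k⁻¹ • (light η - light ξ)) (k⁻¹ • (light η - light ξ)) = -1 := by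
    simp only [map_smul, map_sub, LinearMap.smul_apply, LinearMap.sub_apply,
      smul_eq_mul, mink_light_self, hm', ← hmdef]
    field_simp
    linear_combination hkk
  have hvec : ∀ r, (geodesic x _ hx he r).vec =
      k⁻¹ • (Real.exp r • light η + Real.exp (-r) • light ξ) := by
    intro r
    rw [vec_geodesic, Real.cosh_eq, Real.sinh_eq]
    simp only [x, vec_ofVec]
    module
  have hexp : Tendsto (fun n : ℕ => Real.exp (-(n : ℝ))) atTop (𝓝 0) :=
    Real.tendsto_exp_neg_atTop_nhds_zero.comp tendsto_natCast_atTop_atTop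
  refine ⟨geodesic x _ hx he, ⟨isometry_geodesic hx he, ?_, ?_⟩, hvec⟩
  · refine convergesToBoundary_of_smul (c := fun n => Real.exp (-(n : ℝ)))
      (fun n => Real.exp_pos _) hexp (inv_pos.2 hk0) ?_
    have := (((hexp.mul hexp).smul_const (light η)).add_const (light ξ)).const_smul k⁻¹
    simp only [mul_zero, zero_smul, zero_add] at this
    refine this.congr fun n => ?_
    rw [hvec, neg_neg]
    have : Real.exp (-(n : ℝ)) * Real.exp n = 1 := by rw [← Real.exp_add]; simp
    simp only [smul_add, smul_smul]
    rw [show Real.exp (-(n : ℝ)) * (k⁻¹ * Real.exp n) = k⁻¹ by linear_combination k⁻¹ * this]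
    congr 2
    ring
  · refine convergesToBoundary_of_smul (c := fun n => Real.exp (-(n : ℝ)))
      (fun n => Real.exp_pos _) hexp (inv_pos.2 hk0) ?_
    have := (((hexp.mul hexp).smul_const (light ξ)).const_add (light η)).const_smul k⁻¹
    simp only [mul_zero, zero_smul, add_zero] at this
    refine this.congr fun n => ?_
    rw [hvec]
    have : Real.exp (-(n : ℝ)) * Real.exp n = 1 := by rw [← Real.exp_add]; simp
    simp only [smul_add, smul_smul]
    rw [show Real.exp (-(n : ℝ)) * (k⁻¹ * Real.exp n) = k⁻¹ by linear_combination k⁻¹ * this]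
    congr 2
    ring

theorem eq_smul_light_of_tendsto {s : ℕ → Hyperboloid E} {ζ : GromovBoundary (Hyperboloid E)}
    (h : ConvergesToBoundary s ζ) {c : ℕ → ℝ} {v : ℝ × E}
    (hv : Tendsto (fun n => c n • (s n).vec) atTop (𝓝 v)) : v = v.1 • light ζ := by
  have h1 : Tendsto (fun n => c n * (s n).time) atTop (𝓝 v.1) :=
    (continuous_fst.tendsto _).comp hv
  refine tendsto_nhds_unique hv ((h1.smul (ConvergesToBoundary.tendsto_smul h).2).congr fun n => ?_)
  rw [smul_smul, mul_assoc, mul_inv_cancel₀ (s n).time_pos.ne', mul_one]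

/-- The isotropic endpoints of a geodesic line span its plane. -/
theorem vec_mem_span_of_isGeodesicLine {γ : ℝ → Hyperboloid E}
    {ξ η : GromovBoundary (Hyperboloid E)} (h : IsGeodesicLine γ ξ η) (r : ℝ) :
    (γ r).vec ∈ Submodule.span ℝ {light ξ, light η} := by
  obtain ⟨hγ, h1, h2⟩ := h
  have hs : Real.sinh 1 ≠ 0 := by simp [Real.sinh_eq_zero]
  set x := (γ 0).vec with hx
  set e := (Real.sinh 1)⁻¹ • ((γ 1).vec - Real.cosh 1 • x) with he
  -- In this form `x + e` and `x - e` are the limits of `2 exp (-n) • γ (±n)`, so they lie on the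
  -- isotropic rays of the endpoints.
  have hvec : ∀ r, (γ r).vec =
      (Real.exp r / 2) • (x + e) + (Real.exp (-r) / 2) • (x - e) := by
    intro r
    have h := sinh_smul_geodesic hγ 0 1 r
    rw [sub_zero, sub_zero, Real.sinh_sub] at h
    have h3 : (γ 1).vec = Real.cosh 1 • x + Real.sinh 1 • e := by
      rw [he, smul_smul, mul_inv_cancel₀ hs, one_smul, add_sub_cancel]
    have h4 : Real.sinh 1 • (γ r).vec = Real.sinh 1 • (Real.cosh r • x + Real.sinh r • e) := by
      rw [h, h3, ← hx]
      module
    rw [smul_right_injective _ hs h4, Real.cosh_eq, Real.sinh_eq]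
    module
  clear_value e
  have hexp : Tendsto (fun n : ℕ => Real.exp (-(n : ℝ))) atTop (𝓝 0) :=
    Real.tendsto_exp_neg_atTop_nhds_zero.comp tendsto_natCast_atTop_atTop
  have hη : x + e = (x + e).1 • light η := by
    refine eq_smul_light_of_tendsto h2 (c := fun n => 2 * Real.exp (-(n : ℝ))) ?_
    have := ((hexp.mul hexp).smul_const (x - e)).const_add (x + e)
    simp only [mul_zero, zero_smul, add_zero] at this
    refine this.congr fun n => ?_
    have : Real.exp (-(n : ℝ)) * Real.exp n = 1 := by rw [← Real.exp_add]; simp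
    rw [hvec, smul_add, smul_smul, smul_smul,
      show 2 * Real.exp (-(n : ℝ)) * (Real.exp n / 2) = 1 by linear_combination this, one_smul]
    congr 2
    ring
  have hξ : x - e = (x - e).1 • light ξ := by
    refine eq_smul_light_of_tendsto h1 (c := fun n => 2 * Real.exp (-(n : ℝ))) ?_
    have := ((hexp.mul hexp).smul_const (x + e)).add_const (x - e)
    simp only [mul_zero, zero_smul, zero_add] at this
    refine this.congr fun n => ?_
    have : Real.exp (-(n : ℝ)) * Real.exp n = 1 := by rw [← Real.exp_add]; simp
    rw [hvec, smul_add (2 * _), smul_smul, smul_smul, neg_neg,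
      show 2 * Real.exp (-(n : ℝ)) * (Real.exp n / 2) = 1 by linear_combination this, one_smul]
    congr 2
    ring
  rw [hvec, hη, hξ]
  refine Submodule.add_mem _ (Submodule.smul_mem _ _ (Submodule.smul_mem _ _ ?_))
    (Submodule.smul_mem _ _ (Submodule.smul_mem _ _ ?_))
  · exact Submodule.subset_span (by simp)
  · exact Submodule.subset_span (by simp)

/-- A light vector `light η` is a combination of two points of any line ending at `η`. Such a line
needs a second point of `A`, whence `A.Nontrivial`. -/
theorem isTotal_of_dense_span {A : Set (GromovBoundary (Hyperboloid E))} (hA : A.Nontrivial)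
    (h : (Submodule.span ℝ (light '' A)).topologicalClosure = ⊤) : IsTotalBoundarySet A := by
  intro S hc hS hline
  refine eq_univ_of_dense_span hS hc (eq_top_iff.2 (h ▸ Submodule.topologicalClosure_mono ?_))
  refine Submodule.span_le.2 ?_
  rintro _ ⟨η, hη, rfl⟩
  obtain ⟨ξ, hξ, hne⟩ := hA.exists_ne η
  obtain ⟨γ, hγ, hvec⟩ := exists_geodesicLine hne
  have hm := mink_light_pos hne
  set k := √(2 * mink (light ξ) (light η)) with hk
  have hk0 : 0 < k := Real.sqrt_pos.2 (by positivity)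
  have hmem : ∀ r, (γ r).vec ∈ Submodule.span ℝ (vec '' S) := fun r =>
    Submodule.subset_span ⟨γ r, hline γ ξ hξ η hη hγ r, rfl⟩
  have e1 : Real.exp 1 * Real.exp (-1) = 1 := by rw [← Real.exp_add]; simp
  have e2 : Real.exp (-1) < Real.exp 1 := Real.exp_lt_exp.2 (by norm_num)
  -- The coefficient `exp (-1)` is the one that eliminates `light ξ`.
  have key : (k⁻¹ * (Real.exp 1 - Real.exp (-1))) • light η =
      (γ 1).vec - Real.exp (-1) • (γ 0).vec := by
    simp only [hvec, Real.exp_zero, neg_zero]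
    module
  have h0 : k⁻¹ * (Real.exp 1 - Real.exp (-1)) ≠ 0 :=
    mul_ne_zero (inv_ne_zero hk0.ne') (sub_pos.2 e2).ne'
  refine (Submodule.smul_mem_iff _ h0).1 ?_
  rw [key]
  exact Submodule.sub_mem _ (hmem 1) (Submodule.smul_mem _ _ (hmem 0))

/-- The trace on the hyperboloid of the closed span is closed, totally geodesic and contains all
lines between points of `A`. By totality it is everything, and the hyperboloid spans. -/
theorem dense_span_of_isTotal {A : Set (GromovBoundary (Hyperboloid E))}
    (h : IsTotalBoundarySet A) : (Submodule.span ℝ (light '' A)).topologicalClosure = ⊤ := by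
  set W := (Submodule.span ℝ (light '' A)).topologicalClosure with hW
  have hS := h {x | x.vec ∈ W} ((Submodule.isClosed_topologicalClosure _).preimage continuous_vec)
    (isTotallyGeodesic_preimage W) (by
      intro γ ξ hξ η hη hγ r
      refine Submodule.le_topologicalClosure _ ?_
      refine Submodule.span_mono ?_ (vec_mem_span_of_isGeodesicLine hγ r)
      rintro _ (rfl | rfl)
      · exact ⟨ξ, hξ, rfl⟩
      · exact ⟨η, hη, rfl⟩)
  refine eq_top_iff.2 (span_range_vec.symm.le.trans (Submodule.span_le.2 ?_))
  rintro _ ⟨x, rfl⟩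
  have : x ∈ {x : Hyperboloid E | x.vec ∈ W} := by
    rw [hS]
    trivial
  exact this

end GromovBoundary

end Total

end

noncomputable section

/-! ## The Hilbert space of a kernel of conditionally negative type -/

section GNS

/-- Schoenberg's argument: adjoining `p` with weight `-∑ l i` makes the total weight zero, and
negativity of the enlarged sum is positivity of the kernel centred at `p`. -/
theorem IsCondNegType.sum_nonneg {Z : Type*} {K : Z → Z → ℝ} (hK : IsCondNegType K) (p : Z) (n : ℕ)
    (x : Fin n → Z) (l : Fin n → ℝ) :
    0 ≤ ∑ i, ∑ j, l i * l j * ((K (x i) p + K (x j) p - K (x i) (x j)) / 2) := by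
  have h := hK.nonpos (n + 1) (Fin.cons p x) (Fin.cons (-∑ i, l i) l) (by simp [Fin.sum_univ_succ])
  simp only [Fin.sum_univ_succ, Fin.cons_zero, Fin.cons_succ, hK.diag, mul_zero, zero_add,
    Finset.sum_add_distrib] at h
  have e1 : ∑ i, l i * -(∑ j, l j) * K (x i) p = -((∑ j, l j) * ∑ i, l i * K (x i) p) := by
    generalize ∑ j, l j = c
    rw [Finset.mul_sum, ← Finset.sum_neg_distrib]
    exact Finset.sum_congr rfl fun i _ => by ring
  have e2 : ∑ i, -(∑ j, l j) * l i * K p (x i) = -((∑ j, l j) * ∑ i, l i * K (x i) p) := by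
    generalize ∑ j, l j = c
    rw [Finset.mul_sum, ← Finset.sum_neg_distrib]
    refine Finset.sum_congr rfl fun i _ => ?_
    rw [hK.symm p]
    ring
  have e3 : ∑ i, ∑ j, l i * l j * K (x i) p = (∑ j, l j) * ∑ i, l i * K (x i) p := by
    rw [Finset.sum_mul_sum, Finset.sum_comm]
    exact Finset.sum_congr rfl fun i _ => Finset.sum_congr rfl fun j _ => by ring
  have e4 : ∑ i, ∑ j, l i * l j * K (x j) p = (∑ j, l j) * ∑ i, l i * K (x i) p := by
    rw [Finset.sum_mul_sum]
    exact Finset.sum_congr rfl fun i _ => Finset.sum_congr rfl fun j _ => by ring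
  have e5 : ∑ i, ∑ j, l i * l j * ((K (x i) p + K (x j) p - K (x i) (x j)) / 2) =
      (∑ i, ∑ j, l i * l j * K (x i) p + ∑ i, ∑ j, l i * l j * K (x j) p -
        ∑ i, ∑ j, l i * l j * K (x i) (x j)) / 2 := by
    simp only [← Finset.sum_add_distrib, ← Finset.sum_sub_distrib, Finset.sum_div]
    exact Finset.sum_congr rfl fun i _ => Finset.sum_congr rfl fun j _ => by ring
  rw [e5, e3, e4]
  rw [e1, e2] at h
  linarith

/-- The centred kernel `k` is positive semidefinite, and `g` sends a point to its kernel section in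
the reproducing kernel Hilbert space. Then `k p p = 0` gives `g p = 0`, and `k x x + k y y - 2 k x y
= K x y`. -/
theorem IsCondNegType.exists_hilbert {Z : Type u} {K : Z → Z → ℝ} (hK : IsCondNegType K) (p : Z) :
    ∃ (H : Type u) (_ : NormedAddCommGroup H) (_ : InnerProductSpace ℝ H) (_ : CompleteSpace H)
      (g : Z → H), g p = 0 ∧ (∀ x y, ‖g x - g y‖ ^ 2 = K x y) ∧
        (Submodule.span ℝ (Set.range g)).topologicalClosure = ⊤ := by
  let k : Z → Z → ℝ := fun x y => (K x p + K y p - K x y) / 2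
  let M : Matrix Z Z (ℝ →L[ℝ] ℝ) := Matrix.of fun x y => k x y • (1 : ℝ →L[ℝ] ℝ)
  have hM : M.PosSemidef := by
    have htfae := (RKHS.posSemidef_tfae (K := M)).out 0 2
    refine htfae.2 ⟨?_, fun c => ?_⟩
    · ext x y
      have : k x y = k y x := by simp only [k, hK.symm x y]; ring
      simp [M, Matrix.conjTranspose, this]
    · let e := c.support.equivFin.symm
      have h := hK.sum_nonneg p _ (fun i => (e i : Z)) (fun i => c (e i))
      have hsum : ∀ f : Z → ℝ, ∑ i : Fin c.support.card, f (e i) = ∑ z ∈ c.support, f z :=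
        fun f => (Equiv.sum_comp e fun z => f z).trans (Finset.sum_coe_sort c.support f)
      have h' : 0 ≤ ∑ y ∈ c.support, ∑ z ∈ c.support,
          c y * c z * ((K y p + K z p - K y z) / 2) := by
        rw [← hsum]
        exact h.trans_eq (Finset.sum_congr rfl fun i _ =>
          hsum fun z => c (e i) * c z * ((K (e i) p + K z p - K (e i) z) / 2))
      refine h'.trans_eq (Finset.sum_congr rfl fun y _ => Finset.sum_congr rfl fun z _ => ?_)
      change _ = inner ℝ (k z y * c y) (c z)
      simp only [k, hK.symm z y, Real.inner_apply]
      ring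
  have : Fact M.PosSemidef := ⟨hM⟩
  let g : Z → RKHS.OfKernel M := fun x => RKHS.kerFun (RKHS.OfKernel M) x 1
  have hg : ∀ x y, inner ℝ (g x) (g y) = k x y := by
    intro x y
    have h := RKHS.kernel_inner (RKHS.OfKernel M) x y 1 1
    have h2 : RKHS.kernel (RKHS.OfKernel M) x y 1 = k x y := by
      rw [RKHS.OfKernel.kernel_ofKernel]
      simp [M]
    rw [h2] at h
    rw [real_inner_comm]
    exact h.symm.trans (by simp)
  refine ⟨RKHS.OfKernel M, inferInstance, inferInstance, inferInstance, g, ?_, fun x y => ?_, ?_⟩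
  · have := hg p p
    rw [real_inner_self_eq_norm_sq] at this
    simpa [k, hK.diag] using this
  · rw [norm_sub_sq_real, ← real_inner_self_eq_norm_sq, ← real_inner_self_eq_norm_sq, hg, hg, hg]
    simp only [k, hK.diag]
    ring
  · refine eq_top_iff.2 ((RKHS.kerFun_dense (RKHS.OfKernel M)).symm.le.trans
      (Submodule.topologicalClosure_mono (Submodule.span_le.2 ?_)))
    rintro _ ⟨x, r, rfl⟩
    have : RKHS.kerFun (RKHS.OfKernel M) x r = r • g x := by
      rw [← map_smul, smul_eq_mul, mul_one]
    rw [this]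
    exact Submodule.smul_mem _ _ (Submodule.subset_span ⟨x, rfl⟩)

/-- Every Hilbert space is an `ℓ²` space. -/
theorem exists_linearIsometryEquiv_lp (E : Type u) [NormedAddCommGroup E] [InnerProductSpace ℝ E]
    [CompleteSpace E] :
    ∃ κ : Cardinal.{u}, Nonempty (E ≃ₗᵢ[ℝ] lp (fun _ : κ.out => ℝ) 2) := by
  obtain ⟨w, b, -⟩ := exists_hilbertBasis ℝ E
  let e : (Cardinal.mk w).out ≃ w := Cardinal.outMkEquiv
  have hb : ⊤ ≤ (Submodule.span ℝ (Set.range (b ∘ e))).topologicalClosure := by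
    rw [e.surjective.range_comp, b.dense_span]
  exact ⟨Cardinal.mk w, ⟨(HilbertBasis.mk (b.orthonormal.comp e e.injective) hb).repr⟩⟩

end GNS

/-! ## Normalising an abstract cross-ratio -/

section CrossRatioWeights

set_option linter.unusedSectionVars false

variable {Y : Type*} [TopologicalSpace Y] {R : Y → Y → Y → Y → ℝ≥0∞}

open Classical in
/-- The distance on the complement of `w` defined by a cross-ratio, extended by `1` at `w`. -/
def crossRatioWeight (R : Y → Y → Y → Y → ℝ≥0∞) (p q w x y : Y) : ℝ≥0∞ :=
  if x = y then 0 else if x = w ∨ y = w then 1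
  else if y = p then R x p q w else R x y p w * R y p q w

theorem crossRatioWeight_self (p q w x : Y) : crossRatioWeight R p q w x x = 0 := by
  simp [crossRatioWeight]

theorem crossRatioWeight_right {p q w x : Y} (hx : x ≠ w) : crossRatioWeight R p q w x w = 1 := by
  simp [crossRatioWeight, hx]

theorem crossRatioWeight_left {p q w x : Y} (hx : x ≠ w) : crossRatioWeight R p q w w x = 1 := by
  simp [crossRatioWeight, hx.symm]

theorem crossRatioWeight_base {p q w x : Y} (hx : x ≠ w) (hp : p ≠ w) (hxp : x ≠ p) :
    crossRatioWeight R p q w x p = R x p q w := by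
  simp [crossRatioWeight, hx, hp, hxp]

theorem crossRatioWeight_of_ne {p q w x y : Y} (hx : x ≠ w) (hy : y ≠ w) (hxy : x ≠ y)
    (hyp : y ≠ p) : crossRatioWeight R p q w x y = R x y p w * R y p q w := by
  simp [crossRatioWeight, hx, hy, hxy, hyp]

theorem crossRatioKernel_eq (p q w : Y) (x y : {y : Y // y ≠ w}) :
    crossRatioKernel R p q w x y = (crossRatioWeight R p q w x y).toReal ^ 2 := by
  unfold crossRatioKernel
  by_cases h : x = y
  · simp [h, crossRatioWeight_self]
  · have h' : (x : Y) ≠ y := fun h'' => h (Subtype.ext h'')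
    rw [if_neg h]
    split_ifs with hp
    · rw [hp] at h' ⊢
      rw [crossRatioWeight_base x.2 (hp ▸ y.2) h']
    · rw [crossRatioWeight_of_ne x.2 y.2 h' hp]

namespace IsAbstractCrossRatio

theorem ne_zero (hR : IsAbstractCrossRatio R) {a b c d : Y} (h : AtLeastThreeDistinct a b c d)
    (h1 : a ≠ b) (h2 : c ≠ d) : R a b c d ≠ 0 := fun h0 => by
  rcases (hR.eq_zero_iff _ _ _ _ h).1 h0 with h | h
  exacts [h1 h, h2 h]

theorem ne_top (hR : IsAbstractCrossRatio R) {a b c d : Y} (h : AtLeastThreeDistinct a b c d)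
    (h1 : a ≠ d) (h2 : c ≠ b) : R a b c d ≠ ∞ := fun h0 => by
  rcases (hR.eq_top_iff _ _ _ _ h).1 h0 with h | h
  exacts [h1 h, h2 h]

theorem weight_ne_top (hR : IsAbstractCrossRatio R) {p q w : Y} (hpq : p ≠ q) (hpw : p ≠ w)
    (hqw : q ≠ w) (x y : Y) : crossRatioWeight R p q w x y ≠ ∞ := by
  by_cases hxy : x = y
  · rw [hxy, crossRatioWeight_self]; simp
  by_cases hx : x = w
  · rw [hx, crossRatioWeight_left (hx ▸ Ne.symm hxy)]; simp
  by_cases hy : y = w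
  · rw [hy, crossRatioWeight_right hx]; simp
  by_cases hp : y = p
  · rw [hp] at hxy ⊢
    rw [crossRatioWeight_base hx hpw hxy]
    exact hR.ne_top (Or.inr (Or.inr (Or.inr ⟨hpq, hpw, hqw⟩))) hx hpq.symm
  rw [crossRatioWeight_of_ne hx hy hxy hp]
  refine ENNReal.mul_ne_top ?_ ?_
  · exact hR.ne_top (Or.inr (Or.inr (Or.inr ⟨hp, hy, hpw⟩))) hx (Ne.symm hp)
  · exact hR.ne_top (Or.inr (Or.inr (Or.inr ⟨hpq, hpw, hqw⟩))) hy hpq.symm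

theorem weight_ne_zero (hR : IsAbstractCrossRatio R) {p q w : Y} (hpq : p ≠ q) (hpw : p ≠ w)
    (hqw : q ≠ w) {x y : Y} (hxy : x ≠ y) : crossRatioWeight R p q w x y ≠ 0 := by
  by_cases hx : x = w
  · rw [hx, crossRatioWeight_left (hx ▸ Ne.symm hxy)]; simp
  by_cases hy : y = w
  · rw [hy, crossRatioWeight_right hx]; simp
  by_cases hp : y = p
  · rw [hp] at hxy ⊢
    rw [crossRatioWeight_base hx hpw hxy]
    exact hR.ne_zero (Or.inr (Or.inr (Or.inr ⟨hpq, hpw, hqw⟩))) hxy hqw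
  rw [crossRatioWeight_of_ne hx hy hxy hp]
  refine mul_ne_zero ?_ ?_
  · exact hR.ne_zero (Or.inr (Or.inr (Or.inr ⟨hp, hy, hpw⟩))) hxy hpw
  · exact hR.ne_zero (Or.inr (Or.inr (Or.inr ⟨hpq, hpw, hqw⟩))) hp hqw

/-- The cocycle relation through `p` and inversion give `R a b c w = R a b p w / R c b p w`, and the
factor `R b p q w` common to both weights cancels. When `b = p` the intermediate point is `q`. -/
theorem eq_weight_div (hR : IsAbstractCrossRatio R) {p q w : Y} (hpq : p ≠ q) (hpw : p ≠ w)
    (hqw : q ≠ w) {a b c : Y} (haw : a ≠ w) (hbw : b ≠ w) (hcw : c ≠ w) (hab : a ≠ b)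
    (hcb : c ≠ b) :
    R a b c w = crossRatioWeight R p q w a b / crossRatioWeight R p q w c b := by
  have hq : AtLeastThreeDistinct a b c w := Or.inr (Or.inl ⟨hab, haw, hbw⟩)
  by_cases hbp : b = p
  · subst hbp
    rw [crossRatioWeight_base haw hbw hab, crossRatioWeight_base hcw hbw hcb]
    have h1 : AtLeastThreeDistinct a b q w := Or.inr (Or.inr (Or.inr ⟨hpq, hpw, hqw⟩))
    have h2 : AtLeastThreeDistinct q b c w := Or.inr (Or.inl ⟨hpq.symm, hqw, hpw⟩)
    rw [hR.cocycle a b c w q hq h1 h2 (Or.inl (hR.ne_zero h1 hab hqw))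
      (Or.inl (hR.ne_top h1 haw hpq.symm)), hR.inversion_left q b c w h2, div_eq_mul_inv]
  · rw [crossRatioWeight_of_ne haw hbw hab hbp, crossRatioWeight_of_ne hcw hbw hcb hbp]
    have h1 : AtLeastThreeDistinct a b p w := Or.inr (Or.inr (Or.inr ⟨hbp, hbw, hpw⟩))
    have h2 : AtLeastThreeDistinct p b c w := Or.inr (Or.inl ⟨Ne.symm hbp, hpw, hbw⟩)
    have h3 : AtLeastThreeDistinct b p q w := Or.inr (Or.inr (Or.inr ⟨hpq, hpw, hqw⟩))
    rw [ENNReal.mul_div_mul_right _ _ (hR.ne_zero h3 hbp hqw) (hR.ne_top h3 hbw hpq.symm),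
      hR.cocycle a b c w p hq h1 h2 (Or.inl (hR.ne_zero h1 hab hpw))
      (Or.inl (hR.ne_top h1 haw (Ne.symm hbp))), hR.inversion_left p b c w h2, div_eq_mul_inv]

/-- The case `d = w` is `eq_weight_div`; symmetries of `R` and of the weight move `w` to the other
places, and the cocycle relation through `w` gives the generic case. Coinciding entries give the
values `0`, `∞` or `1`. -/
theorem eq_weights (hR : IsAbstractCrossRatio R) {p q w : Y} (hpq : p ≠ q) (hpw : p ≠ w)
    (hqw : q ≠ w)
    (hsymm : ∀ x y, crossRatioWeight R p q w x y = crossRatioWeight R p q w y x)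
    {a b c d : Y} (hq : AtLeastThreeDistinct a b c d) :
    R a b c d = (crossRatioWeight R p q w a b * crossRatioWeight R p q w c d) /
      (crossRatioWeight R p q w a d * crossRatioWeight R p q w c b) := by
  set δ := crossRatioWeight R p q w with hδ
  have h0 : ∀ x, δ x x = 0 := fun x => crossRatioWeight_self p q w x
  have hw : ∀ x, x ≠ w → δ x w = 1 := fun x hx => crossRatioWeight_right hx
  have hw' : ∀ x, x ≠ w → δ w x = 1 := fun x hx => crossRatioWeight_left hx
  have hne : ∀ {x y}, x ≠ y → δ x y ≠ 0 := fun h => hR.weight_ne_zero hpq hpw hqw h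
  have hnt : ∀ x y, δ x y ≠ ∞ := fun x y => hR.weight_ne_top hpq hpw hqw x y
  have main : ∀ {a b c}, a ≠ w → b ≠ w → c ≠ w → a ≠ b → c ≠ b → R a b c w = δ a b / δ c b :=
    fun h1 h2 h3 h4 h5 => hR.eq_weight_div hpq hpw hqw h1 h2 h3 h4 h5
  -- For `a = c` or `b = d` inversion fixes the quadruple, so `R` is its own inverse there.
  have self : ∀ {x : ℝ≥0∞}, x = x⁻¹ → x = 1 := by
    intro x h
    rcases le_total x 1 with h3 | h3
    · exact le_antisymm h3 (h ▸ ENNReal.one_le_inv.2 h3)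
    · exact le_antisymm (h ▸ ENNReal.inv_le_one.2 h3) h3
  by_cases hab : a = b
  · rw [(hR.eq_zero_iff _ _ _ _ hq).2 (Or.inl hab), hab, h0]; simp
  by_cases hcd : c = d
  · rw [(hR.eq_zero_iff _ _ _ _ hq).2 (Or.inr hcd), hcd, h0]; simp
  by_cases had : a = d
  · rw [(hR.eq_top_iff _ _ _ _ hq).2 (Or.inl had), had, h0, zero_mul,
      ENNReal.div_zero (mul_ne_zero (hne (had ▸ hab)) (hne hcd))]
  by_cases hcb : c = b
  · rw [(hR.eq_top_iff _ _ _ _ hq).2 (Or.inr hcb), hcb, h0, mul_zero,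
      ENNReal.div_zero (mul_ne_zero (hne hab) (hne (hcb ▸ hcd)))]
  have hN : ∀ {x y z t}, x ≠ y → z ≠ t → δ x y * δ z t ≠ 0 :=
    fun h1 h2 => mul_ne_zero (hne h1) (hne h2)
  have hT : ∀ x y z t, δ x y * δ z t ≠ ∞ := fun x y z t => ENNReal.mul_ne_top (hnt _ _) (hnt _ _)
  by_cases hac : a = c
  · subst hac
    rw [mul_comm (δ a d), ENNReal.div_self (hN hab had) (hT _ _ _ _)]
    exact self (hR.inversion_left _ _ _ _ hq)
  by_cases hbd : b = d
  · subst hbd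
    rw [ENNReal.div_self (hN hab hcb) (hT _ _ _ _)]
    exact self (hR.inversion_right _ _ _ _ hq)
  by_cases hdw : d = w
  · subst hdw
    rw [hw a had, hw c hcd, mul_one, one_mul, main had hbd hcd hab hcb]
  by_cases hbw : b = w
  · subst hbw
    rw [hR.exchange _ _ _ _ hq, hw a hab, hw c hcb, mul_one, one_mul,
      main hcb (Ne.symm hbd) hab hcd had]
  by_cases haw : a = w
  · subst haw
    rw [hw' b (Ne.symm hab), hw' d (Ne.symm had), one_mul, one_mul, hR.reverse _ _ _ _ hq,
      hR.exchange _ _ _ _ (Or.inl ⟨Ne.symm hab, hbd, had⟩),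
      main hdw (Ne.symm hac) hbw (Ne.symm hcd) (Ne.symm hcb), hsymm d c, hsymm b c]
  by_cases hcw : c = w
  · subst hcw
    rw [hw' b (Ne.symm hcb), hw' d (Ne.symm hcd), mul_one, mul_one, hR.reverse _ _ _ _ hq,
      main hbw haw hdw (Ne.symm hab) (Ne.symm had), hsymm b a, hsymm d a]
  have q1 : AtLeastThreeDistinct b a d c := Or.inl ⟨Ne.symm hab, hbd, had⟩
  have q2 : AtLeastThreeDistinct b a w c := Or.inr (Or.inl ⟨Ne.symm hab, Ne.symm hcb, hac⟩)
  have q3 : AtLeastThreeDistinct w a d c := Or.inr (Or.inr (Or.inr ⟨had, hac, Ne.symm hcd⟩))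
  have q4 : AtLeastThreeDistinct a b c w := Or.inl ⟨hab, hac, Ne.symm hcb⟩
  have q5 : AtLeastThreeDistinct a w c d := Or.inr (Or.inr (Or.inl ⟨hac, had, hcd⟩))
  -- The result is `R a b c d = R a b c w * R c d a w`.
  rw [hR.reverse _ _ _ _ hq, hR.cocycle b a d c w q1 q2 q3
    (Or.inl (hR.ne_zero q2 (Ne.symm hab) (Ne.symm hcw)))
    (Or.inl (hR.ne_top q2 (Ne.symm hcb) (Ne.symm haw))),
    ← hR.reverse a b c w q4, ← hR.reverse a w c d q5, hR.exchange a w c d q5,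
    main haw hbw hcw hab hcb, main hcw hdw haw hcd had,
    div_eq_mul_inv, div_eq_mul_inv, div_eq_mul_inv,
    ENNReal.mul_inv (Or.inl (hne had)) (Or.inl (hnt _ _))]
  ring

end IsAbstractCrossRatio

end CrossRatioWeights

end

noncomputable section

/-! ## Existence of a realization -/

section Existence

open GromovBoundary

/-! ### Boundary maps realizing a cross-ratio -/

section CrossRatioMap

set_option linter.unusedSectionVars false

variable {E : Type*} [NormedAddCommGroup E] [InnerProductSpace ℝ E] [CompleteSpace E]
  {Y : Type*} [TopologicalSpace Y] {R : Y → Y → Y → Y → ℝ≥0∞}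

theorem nonempty_of_four_le_card (hY : 4 ≤ ENat.card Y) : Nonempty Y := by
  by_contra h
  rw [not_nonempty_iff] at h
  rw [ENat.card_eq_zero_iff_empty Y |>.2 h] at hY
  exact absurd hY (by norm_num)

theorem exists_ne_ne (hY : 4 ≤ ENat.card Y) (y : Y) : ∃ a b : Y, y ≠ a ∧ y ≠ b ∧ a ≠ b := by
  have h1 : (2 : ℕ∞) < Set.encard (Set.univ : Set Y) := by
    rw [Set.encard_univ]
    exact lt_of_lt_of_le (by norm_num) hY
  obtain ⟨a, -, ha⟩ := Set.exists_ne_of_one_lt_encard (lt_trans (by norm_num) h1) y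
  have h2 : (Set.univ \ {y, a} : Set Y).Nonempty := by
    by_contra h
    rw [Set.not_nonempty_iff_eq_empty, Set.sdiff_eq_empty] at h
    exact absurd (Set.encard_le_encard h) (not_le.2 ((Set.encard_pair ha.symm).trans_lt h1))
  obtain ⟨b, -, hb⟩ := h2
  simp only [Set.mem_insert_iff, Set.mem_singleton_iff, not_or] at hb
  exact ⟨a, b, ha.symm, Ne.symm hb.1, Ne.symm hb.2⟩

theorem injective_of_crossRatio_eq (hY : 4 ≤ ENat.card Y) (hR : IsAbstractCrossRatio R)
    {f : Y → GromovBoundary (Hyperboloid E)}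
    (hf : ∀ (o : Hyperboloid E) (a b c d : Y), AtLeastThreeDistinct a b c d →
      boundaryCrossRatio o (f a) (f b) (f c) (f d) = R a b c d) : Function.Injective f := by
  intro x y hxy
  by_contra hne
  have hex : ∃ c d : Y, c ≠ d ∧ x ≠ c ∧ x ≠ d := by
    obtain ⟨a, b, h1, h2, h3⟩ := exists_ne_ne hY x
    exact ⟨a, b, h3, h1, h2⟩
  obtain ⟨c, d, hcd, hxc, hxd⟩ := hex
  -- One of `c`, `d` may equal `y`. The boundary cross-ratio is `0` even then, since `0 / 0 = 0` in
  -- `ℝ≥0∞`.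
  have hq : AtLeastThreeDistinct x y c d := Or.inr (Or.inr (Or.inl ⟨hxc, hxd, hcd⟩))
  refine hR.ne_zero hq hne hcd ?_
  rw [← hf Hyperboloid.origin _ _ _ _ hq, boundaryCrossRatio_eq, hxy]
  simp

/-- Continuity is automatic. By continuity of `R`, `R x y a b` tends to `R y y a b = 0` as `x → y`.
Chords have length at most `2`, so it bounds the chord from `f x` to `f y` up to the constant `4 /
e`. -/
theorem continuous_of_crossRatio_eq (hY : 4 ≤ ENat.card Y) (hR : IsAbstractCrossRatio R)
    {f : Y → GromovBoundary (Hyperboloid E)}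
    (hf : ∀ (o : Hyperboloid E) (a b c d : Y), AtLeastThreeDistinct a b c d →
      boundaryCrossRatio o (f a) (f b) (f c) (f d) = R a b c d) : Continuous f := by
  refine continuous_of_continuous_dir (continuous_iff_continuousAt.2 fun y => ?_)
  obtain ⟨a, b, hya, hyb, hab⟩ := exists_ne_ne hY y
  have hq : ∀ x, AtLeastThreeDistinct x y a b :=
    fun x => Or.inr (Or.inr (Or.inr ⟨hya, hyb, hab⟩))
  have hlim : Tendsto (fun x => R x y a b) (𝓝 y) (𝓝 0) := by
    rw [← (hR.eq_zero_iff y y a b (hq y)).2 (Or.inl rfl)]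
    have h1 := hR.continuousOn (y, y, a, b) (hq y)
    have h2 : Tendsto (fun x : Y => (x, y, a, b)) (𝓝 y) (𝓝[quadruples Y] (y, y, a, b)) :=
      tendsto_nhdsWithin_iff.2 ⟨(Continuous.prodMk_left (y, a, b)).tendsto y,
        Eventually.of_forall hq⟩
    exact h1.tendsto.comp h2
  have hle : ∀ ξ η : GromovBoundary (Hyperboloid E), edist (dir ξ) (dir η) ≤ 2 := by
    intro ξ η
    rw [edist_dist, dist_eq_norm]
    refine ENNReal.ofReal_le_of_le_toReal ((norm_sub_le _ _).trans ?_)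
    rw [norm_dir, norm_dir]
    norm_num
  set e := edist (dir (f a)) (dir (f b)) with he
  have he0 : e ≠ 0 := by
    refine fun h => hab (injective_of_crossRatio_eq hY hR hf (dir_injective (edist_eq_zero.1 h)))
  have hbound : ∀ x, edist (dir (f x)) (dir (f y)) ≤ R x y a b * 4 / e := by
    intro x
    rw [ENNReal.le_div_iff_mul_le (Or.inl he0) (Or.inl (edist_ne_top _ _)),
      ← ENNReal.div_le_iff (by norm_num) (by norm_num),
      ← hf Hyperboloid.origin _ _ _ _ (hq x), boundaryCrossRatio_eq]
    refine ENNReal.div_le_div_left ((mul_le_mul' (hle _ _) (hle _ _)).trans ?_) _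
    norm_num
  refine tendsto_iff_edist_tendsto_0.2 ?_
  refine tendsto_of_tendsto_of_tendsto_of_le_of_le tendsto_const_nhds ?_ (fun _ => zero_le)
    hbound
  have := ENNReal.Tendsto.div_const
    (ENNReal.Tendsto.mul_const (b := 4) hlim (Or.inr (by norm_num))) (Or.inr he0)
  simpa using this

theorem exists_of_isotropic {u : Y → ℝ × E} (ht : ∀ y, 0 < (u y).1)
    (hu : ∀ y, mink (u y) (u y) = 0) :
    ∃ f : Y → GromovBoundary (Hyperboloid E), ∀ y, u y = (u y).1 • light (f y) := by
  have h : ∀ y, ∃ ζ : GromovBoundary (Hyperboloid E), dir ζ = (u y).1⁻¹ • (u y).2 := by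
    intro y
    refine exists_dir_eq ?_
    have h1 := hu y
    rw [mink_apply, real_inner_self_eq_norm_sq] at h1
    have h2 : ‖(u y).2‖ = (u y).1 :=
      (pow_left_inj₀ (norm_nonneg _) (ht y).le two_ne_zero).1 (by linarith)
    rw [norm_smul, norm_inv, Real.norm_eq_abs, abs_of_pos (ht y), h2, inv_mul_cancel₀ (ht y).ne']
  choose f hf using h
  refine ⟨f, fun y => ?_⟩
  ext
  · simp [light]
  · simp [light, hf, smul_smul, (ht y).ne']

theorem exists_realization_of_isotropic (hY : 4 ≤ ENat.card Y) (hR : IsAbstractCrossRatio R)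
    {u : Y → ℝ × E} (ht : ∀ y, 0 < (u y).1) {δ : Y → Y → ℝ≥0∞} (hδ : ∀ x y, δ x y ≠ ∞)
    (hu : ∀ x y, mink (u x) (u y) = 2 * (δ x y).toReal ^ 2) (h0 : ∀ x, δ x x = 0)
    (hRδ : ∀ a b c d, AtLeastThreeDistinct a b c d →
      R a b c d = (δ a b * δ c d) / (δ a d * δ c b))
    (hspan : (Submodule.span ℝ (Set.range u)).topologicalClosure = ⊤) :
    ∃ f : Y → GromovBoundary (Hyperboloid E), Continuous f ∧ IsTotalBoundarySet (Set.range f) ∧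
      ∀ (o : Hyperboloid E) (a b c d : Y), AtLeastThreeDistinct a b c d →
        boundaryCrossRatio o (f a) (f b) (f c) (f d) = R a b c d := by
  obtain ⟨f, hf⟩ := exists_of_isotropic ht fun y => by simp [hu, h0]
  -- Rescaling `u x` and `u y` to time `1` turns the product `2 δ²` into `dist² / 2`, so the chord
  -- is `δ x y * k x * k y`.
  let k : Y → ℝ := fun y => √(2 / (u y).1)
  have hk : ∀ y, 0 < k y := fun y => Real.sqrt_pos.2 (div_pos two_pos (ht y))
  have he : ∀ x y, edist (dir (f x)) (dir (f y)) =
      δ x y * ENNReal.ofReal (k x) * ENNReal.ofReal (k y) := by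
    intro x y
    have hx := ht x
    have hy := ht y
    have h1 := hu x y
    rw [hf x, hf y] at h1
    simp only [map_smul, LinearMap.smul_apply, smul_eq_mul, mink_light] at h1
    rw [edist_dist, ← ENNReal.ofReal_toReal (hδ x y), ← ENNReal.ofReal_mul ENNReal.toReal_nonneg,
      ← ENNReal.ofReal_mul (mul_nonneg ENNReal.toReal_nonneg (hk x).le)]
    congr 1
    refine (pow_left_inj₀ dist_nonneg (mul_nonneg (mul_nonneg ENNReal.toReal_nonneg (hk x).le)
      (hk y).le) two_ne_zero).1 ?_
    simp only [k, mul_pow]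
    rw [Real.sq_sqrt (by positivity), Real.sq_sqrt (by positivity)]
    field_simp
    linear_combination 2 * h1
  have hcr : ∀ (o : Hyperboloid E) (a b c d : Y), AtLeastThreeDistinct a b c d →
      boundaryCrossRatio o (f a) (f b) (f c) (f d) = R a b c d := by
    intro o a b c d h
    rw [boundaryCrossRatio_eq, hRδ a b c d h]
    exact crossRatio_rescale he (fun x => (ENNReal.ofReal_pos.2 (hk x)).ne')
      (fun x => ENNReal.ofReal_ne_top) a b c d
  refine ⟨f, continuous_of_crossRatio_eq hY hR hcr, isTotal_of_dense_span ?_ ?_, hcr⟩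
  · have : Nontrivial Y := by
      have := nonempty_of_four_le_card hY
      obtain ⟨a, b, h, -, -⟩ := exists_ne_ne hY (Classical.arbitrary Y)
      exact ⟨_, _, h⟩
    rw [← Set.image_univ]
    exact Set.nontrivial_univ.image (injective_of_crossRatio_eq hY hR hcr)
  · refine eq_top_iff.2 (hspan.symm.le.trans (Submodule.topologicalClosure_mono
      (Submodule.span_le.2 ?_)))
    rintro _ ⟨y, rfl⟩
    rw [hf]
    exact Submodule.smul_mem _ _ (Submodule.subset_span ⟨f y, ⟨y, rfl⟩, rfl⟩)

end CrossRatioMap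

/-- The isotropic vectors of the horospherical model over a Hilbert space. -/
theorem exists_isotropic {Y : Type u} {H : Type u} [NormedAddCommGroup H] [InnerProductSpace ℝ H]
    (w p : Y) (hpw : p ≠ w) (g : {y : Y // y ≠ w} → H)
    (hg : g ⟨p, hpw⟩ = 0) (hspan : (Submodule.span ℝ (Set.range g)).topologicalClosure = ⊤) :
    ∃ u : Y → ℝ × WithLp 2 (H × ℝ), (∀ y, 0 < (u y).1) ∧
      (∀ x y (hx : x ≠ w) (hy : y ≠ w),
        mink (u x) (u y) = 2 * ‖g ⟨x, hx⟩ - g ⟨y, hy⟩‖ ^ 2) ∧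
      (∀ x, x ≠ w → mink (u x) (u w) = 2) ∧ mink (u w) (u w) = 0 ∧
      (Submodule.span ℝ (Set.range u)).topologicalClosure = ⊤ := by
  classical
  -- The point `w` goes to an isotropic vector, and the others to the section of the light cone
  -- where the product with it is `2`; this section is a paraboloid over `H`.
  let u : Y → ℝ × WithLp 2 (H × ℝ) := fun y =>
    if h : y = w then (1, WithLp.toLp 2 (0, 1))
    else (‖g ⟨y, h⟩‖ ^ 2 + 1, WithLp.toLp 2 ((2 : ℝ) • g ⟨y, h⟩, ‖g ⟨y, h⟩‖ ^ 2 - 1))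
  have hw : u w = (1, WithLp.toLp 2 (0, 1)) := dif_pos rfl
  have hu : ∀ y (h : y ≠ w), u y =
      (‖g ⟨y, h⟩‖ ^ 2 + 1, WithLp.toLp 2 ((2 : ℝ) • g ⟨y, h⟩, ‖g ⟨y, h⟩‖ ^ 2 - 1)) :=
    fun y h => dif_neg h
  refine ⟨u, fun y => ?_, fun x y hx hy => ?_, fun x hx => ?_, ?_, ?_⟩
  · by_cases h : y = w
    · rw [h, hw]; exact one_pos
    · rw [hu y h]; positivity
  · rw [hu x hx, hu y hy, mink_apply, norm_sub_sq_real]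
    simp only [WithLp.prod_inner_apply, real_inner_smul_left, real_inner_smul_right,
      Real.inner_apply]
    ring
  · rw [hu x hx, hw, mink_apply]
    simp
    ring
  · rw [hw, mink_apply]
    simp
  · set W := (Submodule.span ℝ (Set.range u)).topologicalClosure with hW
    have hmem : ∀ y, u y ∈ W := fun y =>
      Submodule.le_topologicalClosure _ (Submodule.subset_span ⟨y, rfl⟩)
    have h1 := hmem w
    have h2 := hmem p
    rw [hw] at h1
    rw [hu p hpw, hg] at h2
    -- As `g p = 0`, the vectors `u w` and `u p` are `(1, 0, 1)` and `(1, 0, -1)`, with half-sum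
    -- `(1, 0, 0)`. Together they yield both real coordinates, and what remains of each `u y` is `2
    -- • g y`.
    have e0 : ((1, 0) : ℝ × WithLp 2 (H × ℝ)) ∈ W := by
      have := W.smul_mem (2⁻¹ : ℝ) (W.add_mem h1 h2)
      convert this using 1
      refine Prod.ext ?_ (WithLp.ofLp_injective 2 (Prod.ext ?_ ?_)) <;> norm_num [smul_smul]
    have e1 : ((0, WithLp.toLp 2 (0, 1)) : ℝ × WithLp 2 (H × ℝ)) ∈ W := by
      have := W.sub_mem h1 e0
      convert this using 1
      refine Prod.ext ?_ (WithLp.ofLp_injective 2 (Prod.ext ?_ ?_)) <;> norm_num [smul_smul]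
    let L : H →L[ℝ] ℝ × WithLp 2 (H × ℝ) :=
      (ContinuousLinearMap.inr ℝ ℝ (WithLp 2 (H × ℝ))).comp
        ((WithLp.prodContinuousLinearEquiv 2 ℝ H ℝ).symm.toContinuousLinearMap.comp
          (ContinuousLinearMap.inl ℝ H ℝ))
    have hL : ∀ z, L z = (0, WithLp.toLp 2 (z, 0)) := fun z => rfl
    have e2 : ∀ z, L z ∈ W := by
      have hle : Submodule.span ℝ (Set.range g) ≤ W.comap (L : H →ₗ[ℝ] ℝ × WithLp 2 (H × ℝ)) := by
        refine Submodule.span_le.2 ?_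
        rintro _ ⟨⟨y, hy⟩, rfl⟩
        have h3 := hmem y
        rw [hu y hy] at h3
        have h4 := W.smul_mem (2⁻¹ : ℝ) (W.sub_mem (W.sub_mem h3
          (W.smul_mem (‖g ⟨y, hy⟩‖ ^ 2 + 1) e0)) (W.smul_mem (‖g ⟨y, hy⟩‖ ^ 2 - 1) e1))
        change L _ ∈ W
        rw [hL]
        convert h4 using 1
        refine Prod.ext ?_ (WithLp.ofLp_injective 2 (Prod.ext ?_ ?_)) <;> norm_num [smul_smul]
      have hcl : IsClosed {z | L z ∈ W} :=
        (Submodule.isClosed_topologicalClosure _).preimage L.continuous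
      intro z
      have hz : z ∈ closure (Submodule.span ℝ (Set.range g) : Set H) := by
        rw [← Submodule.topologicalClosure_coe, hspan]
        trivial
      exact hcl.closure_subset_iff.2 hle hz
    refine eq_top_iff.2 fun v _ => ?_
    have := W.add_mem (W.add_mem (W.smul_mem v.1 e0) (W.smul_mem v.2.snd e1)) (e2 v.2.fst)
    rw [hL] at this
    convert this using 1
    refine Prod.ext ?_ (WithLp.ofLp_injective 2 (Prod.ext ?_ ?_)) <;> norm_num [smul_smul]

/-- A linear isometry of the space components preserves the Minkowski form. -/
theorem mink_prodMap {E F : Type*} [NormedAddCommGroup E] [InnerProductSpace ℝ E]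
    [NormedAddCommGroup F] [InnerProductSpace ℝ F] (Φ : E ≃ₗᵢ[ℝ] F) (v w : ℝ × E) :
    mink (v.1, Φ v.2) (w.1, Φ w.2) = mink v w := by
  simp only [mink_apply, Φ.inner_map_map]

theorem dense_span_prodMap {E F : Type*} [NormedAddCommGroup E] [InnerProductSpace ℝ E]
    [NormedAddCommGroup F] [InnerProductSpace ℝ F] (Φ : E ≃ₗᵢ[ℝ] F) {Y : Type*} {u : Y → ℝ × E}
    (h : (Submodule.span ℝ (Set.range u)).topologicalClosure = ⊤) :
    (Submodule.span ℝ (Set.range fun y => ((u y).1, Φ (u y).2))).topologicalClosure = ⊤ := by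
  let L : (ℝ × E) ≃L[ℝ] (ℝ × F) :=
    (ContinuousLinearEquiv.refl ℝ ℝ).prodCongr Φ.toContinuousLinearEquiv
  have h1 : (Set.range fun y => ((u y).1, Φ (u y).2)) = L '' Set.range u := by
    rw [← Set.range_comp]
    rfl
  rw [← Submodule.dense_iff_topologicalClosure_eq_top] at h ⊢
  rw [h1]
  have h2 := L.surjective.denseRange.dense_image L.continuous h
  refine h2.mono ?_
  rintro _ ⟨v, hv, rfl⟩
  have := Submodule.mem_map_of_mem (f := (L : (ℝ × E) →ₗ[ℝ] (ℝ × F))) hv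
  rw [Submodule.map_span] at this
  exact this

theorem exists_realizesCrossRatio {Y : Type u} [TopologicalSpace Y] (hY : 4 ≤ ENat.card Y)
    {R : Y → Y → Y → Y → ℝ≥0∞} (hR : IsAlgebraicCrossRatio R) :
    ∃ (κ : Cardinal.{u}) (f : Y → GromovBoundary (AlgHyperbolicSpace κ)),
      RealizesCrossRatio R κ f := by
  obtain ⟨w⟩ := nonempty_of_four_le_card hY
  obtain ⟨p, q, hwp, hwq, hpq⟩ := exists_ne_ne hY w
  have hK := hR.condNegType p q w hpq hwp.symm hwq.symm
  have hA := hR.toIsAbstractCrossRatio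
  obtain ⟨H, _, _, _, g, hg0, hg, hspan⟩ := hK.exists_hilbert ⟨p, hwp.symm⟩
  obtain ⟨u, ht, hu, huw, hww, hdense⟩ := exists_isotropic w p hwp.symm g hg0 hspan
  obtain ⟨κ, ⟨Φ⟩⟩ := exists_linearIsometryEquiv_lp (WithLp 2 (H × ℝ))
  have hnt : ∀ x y, crossRatioWeight R p q w x y ≠ ∞ :=
    hA.weight_ne_top hpq hwp.symm hwq.symm
  have hm : ∀ x y, mink (u x) (u y) = 2 * (crossRatioWeight R p q w x y).toReal ^ 2 := by
    intro x y
    by_cases hx : x = w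
    · by_cases hy : y = w
      · rw [hx, hy, hww, crossRatioWeight_self]; simp
      · rw [hx, mink_comm, huw y hy, crossRatioWeight_left hy]; simp
    · by_cases hy : y = w
      · rw [hy, huw x hx, crossRatioWeight_right hx]; simp
      · rw [hu x y hx hy, hg, crossRatioKernel_eq]
  -- Symmetry of the weight is read off from that of the Minkowski form.
  have hsymm : ∀ x y, crossRatioWeight R p q w x y = crossRatioWeight R p q w y x := by
    intro x y
    have h1 := hm x y
    rw [mink_comm, hm y x] at h1
    refine (ENNReal.toReal_eq_toReal_iff' (hnt _ _) (hnt _ _)).1 ?_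
    exact (pow_left_inj₀ ENNReal.toReal_nonneg ENNReal.toReal_nonneg two_ne_zero).1
      (mul_left_cancel₀ two_ne_zero h1.symm)
  obtain ⟨f, h1, h2, h3⟩ := exists_realization_of_isotropic hY hA
    (u := fun y => ((u y).1, Φ (u y).2)) ht hnt
    (fun x y => (mink_prodMap Φ _ _).trans (hm x y)) (fun x => crossRatioWeight_self p q w x)
    (fun a b c d h => hA.eq_weights hpq hwp.symm hwq.symm hsymm h) (dense_span_prodMap Φ hdense)
  exact ⟨κ, f, h1, h2, h3⟩

end Existence

end

noncomputable section

/-! ## Uniqueness of the realization -/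

section Uniqueness

set_option linter.unusedSectionVars false

open GromovBoundary Hyperboloid

/-- A function of pairs without multiplicative curvature is a product. -/
theorem exists_mul_of_four_cycle {Y : Type*} {ρ : Y → Y → ℝ} (hsymm : ∀ x y, ρ x y = ρ y x)
    (hpos : ∀ x y, x ≠ y → 0 < ρ x y)
    (h : ∀ a b c d, AtLeastThreeDistinct a b c d → a ≠ b → c ≠ d → a ≠ d → c ≠ b →
      ρ a b * ρ c d = ρ a d * ρ c b) {p q w : Y} (hpq : p ≠ q) (hpw : p ≠ w) (hqw : q ≠ w) :
    ∃ μ : Y → ℝ, (∀ y, 0 < μ y) ∧ ∀ x y, x ≠ y → ρ x y = μ x * μ y := by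
  classical
  -- The value forced on `μ p`: if `ρ x y = μ x * μ y`, the quotient under the root is `μ p ^ 2`.
  set m := √(ρ p q * ρ p w / ρ q w) with hm
  have h1 := hpos _ _ hpq
  have h2 := hpos _ _ hpw
  have h3 := hpos _ _ hqw
  have hm0 : 0 < m := Real.sqrt_pos.2 (by positivity)
  have hmm : m ^ 2 * ρ q w = ρ p q * ρ p w := by
    rw [hm, Real.sq_sqrt (by positivity)]
    field_simp
  have key : ∀ x y, x ≠ y → x ≠ p → y ≠ p → ρ x y * (ρ p q * ρ p w) = ρ x p * ρ y p * ρ q w := by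
    intro x y hxy hx hy
    by_cases hxq : x = q
    · subst hxq
      have := h x y p w (Or.inr (Or.inr (Or.inl ⟨hpq.symm, hqw, hpw⟩))) hxy hpw hqw hy.symm
      rw [hsymm y p, hsymm x p]
      linear_combination ρ p x * this
    · have e1 := h x y p q (Or.inl ⟨hxy, hx, hy⟩) hxy hpq hxq hy.symm
      have e2 := h q x p w (Or.inr (Or.inr (Or.inl ⟨hpq.symm, hqw, hpw⟩))) (Ne.symm hxq) hpw hqw
        hx.symm
      rw [hsymm y p, hsymm x p]
      rw [hsymm q x] at e2
      linear_combination ρ p w * e1 + ρ p y * e2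
  refine ⟨fun y => if y = p then m else ρ y p / m, fun y => ?_, fun x y hxy => ?_⟩
  · by_cases hy : y = p
    · simp [hy, hm0]
    · have := hpos _ _ hy
      simp only [hy, if_false]
      positivity
  · by_cases hx : x = p
    · have hy : y ≠ p := fun hy => hxy (hx.trans hy.symm)
      simp only [hx, hy, if_true, if_false]
      rw [hsymm]
      field_simp
    · by_cases hy : y = p
      · simp only [hx, hy, if_true, if_false]
        field_simp
      · simp only [hx, hy, if_false]
        have := key x y hxy hx hy
        rw [← hmm] at this
        have h4 : ρ x y * m ^ 2 = ρ x p * ρ y p :=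
          mul_right_cancel₀ h3.ne' (by linear_combination this)
        field_simp
        linear_combination h4

/-! ### Moving a point to the origin -/

section Reflection

variable {E : Type*} [NormedAddCommGroup E] [InnerProductSpace ℝ E]

/-- The linear form given by a vector of the Minkowski space. -/
def minkCLM (m : ℝ × E) : (ℝ × E) →L[ℝ] ℝ :=
  ⟨mink m, continuous_mink.comp (Continuous.prodMk_right m)⟩

theorem minkCLM_apply (m v : ℝ × E) : minkCLM m v = mink m v := rfl

/-- The reflection of the Minkowski space in the line of a vector. -/
def pointReflection (m : ℝ × E) : (ℝ × E) →L[ℝ] (ℝ × E) :=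
  (2 / mink m m) • (minkCLM m).smulRight m - ContinuousLinearMap.id ℝ _

theorem pointReflection_apply (m v : ℝ × E) :
    pointReflection m v = (2 / mink m m * mink m v) • m - v := by
  simp [pointReflection, minkCLM_apply, smul_smul]

theorem mink_pointReflection {m : ℝ × E} (hm : mink m m ≠ 0) (v w : ℝ × E) :
    mink (pointReflection m v) (pointReflection m w) = mink v w := by
  simp only [pointReflection_apply, map_sub, map_smul, LinearMap.sub_apply, LinearMap.smul_apply,
    smul_eq_mul, mink_comm v m]
  field_simp
  ring

theorem pointReflection_pointReflection {m : ℝ × E} (hm : mink m m ≠ 0) (v : ℝ × E) :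
    pointReflection m (pointReflection m v) = v := by
  have h : 2 / mink m m * mink m m = 2 := div_mul_cancel₀ _ hm
  simp only [pointReflection_apply, map_sub, map_smul, h]
  module

/-- A linear isometry of the Minkowski space which moves a point to the origin. -/
theorem exists_toOrigin (z : Hyperboloid E) : ∃ s : (ℝ × E) ≃L[ℝ] (ℝ × E),
    (∀ v w, mink (s v) (s w) = mink v w) ∧ s z.vec = (1, 0) := by
  set o : ℝ × E := (1, 0) with ho
  have hoo : mink o o = 1 := by simp [mink_apply, ho]
  have hzz := mink_vec_self z
  have hzo : mink o z.vec = z.time := by simp [mink_apply, ho, vec]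
  have hz := z.time_pos
  have hm : mink (z.vec + o) (z.vec + o) = 2 * (1 + z.time) := by
    simp only [map_add, LinearMap.add_apply, hoo, hzz, mink_comm z.vec o, hzo]
    ring
  have hm0 : mink (z.vec + o) (z.vec + o) ≠ 0 := by
    rw [hm]; positivity
  -- The line of `z + o` bisects `z` and the origin, so the reflection in it exchanges them; it is
  -- its own inverse.
  refine ⟨ContinuousLinearEquiv.equivOfInverse (pointReflection (z.vec + o))
    (pointReflection (z.vec + o)) (pointReflection_pointReflection hm0)
    (pointReflection_pointReflection hm0), mink_pointReflection hm0, ?_⟩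
  change pointReflection (z.vec + o) z.vec = o
  rw [pointReflection_apply, hm]
  simp only [map_add, LinearMap.add_apply, hzz, hzo]
  have : 2 / (2 * (1 + z.time)) * (1 + z.time) = 1 := by field_simp
  rw [this, one_smul, add_sub_cancel_left]

end Reflection

/-! ### Linear and isometric extensions -/

section Extension

variable {E : Type*} [NormedAddCommGroup E] [InnerProductSpace ℝ E] [CompleteSpace E]
  {F : Type*} [NormedAddCommGroup F] [InnerProductSpace ℝ F] [CompleteSpace F] {Y : Type*}

/-- Total families with the same Gram matrix for the Minkowski form are isometric. -/
theorem exists_minkowskiEquiv {u : Y → ℝ × E} {v : Y → ℝ × F}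
    (huv : ∀ x y, mink (u x) (u y) = mink (v x) (v y))
    (hu : (Submodule.span ℝ (Set.range u)).topologicalClosure = ⊤)
    (hv : (Submodule.span ℝ (Set.range v)).topologicalClosure = ⊤)
    (z : Hyperboloid E) (z' : Hyperboloid F)
    (hz : ∀ y, mink z.vec (u y) = mink z'.vec (v y)) :
    Nonempty (E ≃ₗᵢ[ℝ] F) ∧ ∃ T : (ℝ × E) ≃L[ℝ] (ℝ × F), (∀ a b, mink (T a) (T b) = mink a b) ∧
      (∀ y, T (u y) = v y) ∧ T z.vec = z'.vec := by
  -- The form is indefinite, so its preservation does not by itself bound a linear map on a dense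
  -- span. With `z` and `z'` at the origin, the time coordinate is the product with `z` or `z'`, and
  -- the squared norm of the space part is time squared minus the Minkowski square; both agree on
  -- the two sides.
  obtain ⟨s, hs, hsz⟩ := exists_toOrigin z
  obtain ⟨s', hs', hsz'⟩ := exists_toOrigin z'
  let U : (Y →₀ ℝ) →ₗ[ℝ] ℝ × E := Finsupp.linearCombination ℝ u
  let V : (Y →₀ ℝ) →ₗ[ℝ] ℝ × F := Finsupp.linearCombination ℝ v
  have hUV : ∀ c, mink (U c) (U c) = mink (V c) (V c) := by
    intro c
    simp only [U, V, Finsupp.linearCombination_apply, Finsupp.sum, map_sum, LinearMap.sum_apply,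
      map_smul, LinearMap.smul_apply, huv]
  have hzUV : ∀ c, mink z.vec (U c) = mink z'.vec (V c) := by
    intro c
    simp only [U, V, Finsupp.linearCombination_apply, Finsupp.sum, map_sum, map_smul, hz]
  have hfst : ∀ a, (s a).1 = mink z.vec a := by
    intro a
    rw [← hs, hsz]
    simp [mink_apply]
  have hfst' : ∀ a, (s' a).1 = mink z'.vec a := by
    intro a
    rw [← hs', hsz']
    simp [mink_apply]
  let e₁ : (Y →₀ ℝ) →ₗ[ℝ] E := (LinearMap.snd ℝ ℝ E) ∘ₗ (s : (ℝ × E) →ₗ[ℝ] (ℝ × E)) ∘ₗ U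
  let e₂ : (Y →₀ ℝ) →ₗ[ℝ] F := (LinearMap.snd ℝ ℝ F) ∘ₗ (s' : (ℝ × F) →ₗ[ℝ] (ℝ × F)) ∘ₗ V
  have hd₁ : DenseRange e₁ := by
    have h1 : DenseRange U := by
      rw [DenseRange, ← LinearMap.coe_range, Finsupp.range_linearCombination]
      exact Submodule.dense_iff_topologicalClosure_eq_top.2 hu
    have h2 : DenseRange (Prod.snd ∘ s : ℝ × E → E) :=
      (Prod.snd_surjective.comp s.surjective).denseRange
    exact h2.comp h1 (continuous_snd.comp s.continuous)
  have hd₂ : DenseRange e₂ := by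
    have h1 : DenseRange V := by
      rw [DenseRange, ← LinearMap.coe_range, Finsupp.range_linearCombination]
      exact Submodule.dense_iff_topologicalClosure_eq_top.2 hv
    have h2 : DenseRange (Prod.snd ∘ s' : ℝ × F → F) :=
      (Prod.snd_surjective.comp s'.surjective).denseRange
    exact h2.comp h1 (continuous_snd.comp s'.continuous)
  -- Working on the free vector space over `Y`, this equality of seminorms also takes care of linear
  -- relations among the `u y`.
  have hnorm : ∀ c, ‖e₂ (LinearEquiv.refl ℝ (Y →₀ ℝ) c)‖ = ‖e₁ c‖ := by
    intro c
    refine (pow_left_inj₀ (norm_nonneg _) (norm_nonneg _) two_ne_zero).1 ?_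
    change ‖(s' (V c)).2‖ ^ 2 = ‖(s (U c)).2‖ ^ 2
    have h1 := hs (U c) (U c)
    have h2 := hs' (V c) (V c)
    rw [mink_apply, real_inner_self_eq_norm_sq, hfst] at h1
    rw [mink_apply, real_inner_self_eq_norm_sq, hfst', ← hzUV, ← hUV] at h2
    linarith
  let Φ : E ≃ₗᵢ[ℝ] F :=
    LinearEquiv.extendOfIsometry (LinearEquiv.refl ℝ (Y →₀ ℝ)) e₁ e₂ hd₁ hd₂ hnorm
  have hΦ : ∀ y, Φ (s (u y)).2 = (s' (v y)).2 := by
    intro y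
    have := LinearEquiv.extendOfIsometry_eq (LinearEquiv.refl ℝ (Y →₀ ℝ)) e₁ e₂ hd₁ hd₂ hnorm
      (Finsupp.single y 1)
    simpa [e₁, e₂, U, V] using this
  let L : (ℝ × E) ≃L[ℝ] (ℝ × F) :=
    (ContinuousLinearEquiv.refl ℝ ℝ).prodCongr Φ.toContinuousLinearEquiv
  have hL : ∀ a, L a = (a.1, Φ a.2) := fun a => rfl
  refine ⟨⟨Φ⟩, (s.trans L).trans s'.symm, fun a b => ?_, fun y => ?_, ?_⟩
  · rw [← hs']
    simp only [ContinuousLinearEquiv.trans_apply, ContinuousLinearEquiv.apply_symm_apply, hL]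
    rw [mink_prodMap, hs]
  · simp only [ContinuousLinearEquiv.trans_apply]
    rw [ContinuousLinearEquiv.symm_apply_eq, hL, hΦ, hfst, hz, ← hfst']
  · simp only [ContinuousLinearEquiv.trans_apply]
    rw [ContinuousLinearEquiv.symm_apply_eq, hL, hsz, hsz']
    simp

/-- If `v` were on the lower sheet, `-v` would be a point and its product with `z` would be at least
`1`. -/
theorem fst_pos_of_mink_pos {v : ℝ × E} (z : Hyperboloid E) (hv : mink v v = 1)
    (hz : 0 < mink v z.vec) : 0 < v.1 := by
  by_contra h
  have h1 : v.1 ≠ 0 := by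
    intro h0
    rw [mink_apply, h0, real_inner_self_eq_norm_sq] at hv
    nlinarith [sq_nonneg ‖v.2‖]
  have h2 : 0 < (-v).1 := by
    have := lt_of_le_of_ne (not_lt.1 h) h1
    simpa using this
  have h3 := one_le_form (ofVec (-v) h2 (by simpa using hv)) z
  rw [form_eq_mink, vec_ofVec] at h3
  simp only [map_neg, LinearMap.neg_apply] at h3
  linarith

/-- The map of hyperboloids induced by a linear isometry of Minkowski spaces. -/
theorem exists_isometryEquiv (T : (ℝ × E) ≃L[ℝ] (ℝ × F))
    (hT : ∀ a b, mink (T a) (T b) = mink a b) {z : Hyperboloid E} {z' : Hyperboloid F}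
    (hz : T z.vec = z'.vec) :
    ∃ φ : Hyperboloid E ≃ᵢ Hyperboloid F, ∀ x, (φ x).vec = T x.vec := by
  have hT' : ∀ a b, mink (T.symm a) (T.symm b) = mink a b := fun a b => by
    rw [← hT, T.apply_symm_apply, T.apply_symm_apply]
  have hz' : T.symm z'.vec = z.vec := by rw [← hz, T.symm_apply_apply]
  have h1 : ∀ x : Hyperboloid E, mink (T x.vec) (T x.vec) = 1 := fun x => by
    rw [hT, mink_vec_self]
  have h1' : ∀ x : Hyperboloid F, mink (T.symm x.vec) (T.symm x.vec) = 1 := fun x => by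
    rw [hT', mink_vec_self]
  -- Sending one point of the upper sheet to the upper sheet excludes an exchange of sheets.
  have h0 : ∀ x : Hyperboloid E, 0 < (T x.vec).1 := fun x =>
    fst_pos_of_mink_pos z' (h1 x) (by
      rw [← hz, hT, ← form_eq_mink]
      linarith [one_le_form x z])
  have h0' : ∀ x : Hyperboloid F, 0 < (T.symm x.vec).1 := fun x =>
    fst_pos_of_mink_pos z (h1' x) (by
      rw [← hz', hT', ← form_eq_mink]
      linarith [one_le_form x z'])
  let φ : Hyperboloid E ≃ Hyperboloid F :=
    { toFun := fun x => ofVec (T x.vec) (h0 x) (h1 x)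
      invFun := fun x => ofVec (T.symm x.vec) (h0' x) (h1' x)
      left_inv := fun x => vec_injective (by simp only [vec_ofVec, T.symm_apply_apply])
      right_inv := fun x => vec_injective (by simp only [vec_ofVec, T.apply_symm_apply]) }
  refine ⟨⟨φ, isometry_iff_form.2 fun x y => ?_⟩, fun x => rfl⟩
  rw [form_eq_mink, form_eq_mink]
  exact hT _ _

theorem convergesToBoundary_limit (s : InfinitySeq (Hyperboloid E)) :
    ConvergesToBoundary s.1 s.limit := ⟨s.2, rfl⟩

theorem boundaryMap_eq_of_light {T : (ℝ × E) ≃L[ℝ] (ℝ × F)} {φ : Hyperboloid E → Hyperboloid F}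
    (hφ : Isometry φ) (h : ∀ x, (φ x).vec = T x.vec) {ξ : GromovBoundary (Hyperboloid E)}
    {η : GromovBoundary (Hyperboloid F)} {t : ℝ} (ht : 0 < t) (hT : T (light ξ) = t • light η) :
    boundaryMap φ hφ ξ = η := by
  obtain ⟨s, rfl⟩ := exists_limit_eq ξ
  obtain ⟨h1, h2⟩ := ConvergesToBoundary.tendsto_smul (convergesToBoundary_limit s)
  have h3 : ConvergesToBoundary (fun n => φ (s.1 n)) η := by
    refine convergesToBoundary_of_smul (fun n => inv_pos.2 (s.1 n).time_pos) h1 ht ?_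
    rw [← hT]
    refine ((T.continuous.tendsto _).comp h2).congr fun n => ?_
    rw [Function.comp_apply, map_smul, h]
  exact h3.choose_spec

theorem convergesToBoundary_map {ψ : Hyperboloid E → Hyperboloid F} (hψ : Isometry ψ)
    (s : InfinitySeq (Hyperboloid E)) :
    ConvergesToBoundary (fun n => ψ (s.1 n)) (boundaryMap ψ hψ s.limit) :=
  ⟨(s.map ψ hψ).2, rfl⟩

/-- Distance-preserving maps act on horofunctions by scaling. -/
theorem exists_mink_light_boundaryMap {ψ : Hyperboloid E → Hyperboloid F} (hψ : Isometry ψ)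
    (ζ : GromovBoundary (Hyperboloid E)) :
    ∃ c : ℝ, 0 < c ∧ ∀ x, mink (ψ x).vec (light (boundaryMap ψ hψ ζ)) =
      c * mink x.vec (light ζ) := by
  obtain ⟨s, rfl⟩ := exists_limit_eq ζ
  have h1 := (ConvergesToBoundary.tendsto_smul (convergesToBoundary_limit s)).2
  have h2 := (ConvergesToBoundary.tendsto_smul (convergesToBoundary_map hψ s)).2
  -- The sequence does not involve `x`, because `ψ` preserves the form; hence neither does its
  -- limit, the scale `c`. Linearity of `ψ` is not needed.
  have key : ∀ x, Tendsto (fun n => (s.1 n).time / (ψ (s.1 n)).time) atTop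
      (𝓝 (mink (ψ x).vec (light (boundaryMap ψ hψ s.limit)) / mink x.vec (light s.limit))) := by
    intro x
    have h3 := (tendsto_const_nhds (x := x.vec)).mink h1
    have h4 := (tendsto_const_nhds (x := (ψ x).vec)).mink h2
    refine (h4.div h3 (mink_vec_light x _).ne').congr fun n => ?_
    simp only [Pi.div_apply, map_smul, smul_eq_mul, ← form_eq_mink, isometry_iff_form.1 hψ]
    have := (s.1 n).time_pos
    have := (ψ (s.1 n)).time_pos
    have := one_le_form x (s.1 n)
    field_simp
  refine ⟨_, div_pos (mink_vec_light (ψ origin) (boundaryMap ψ hψ s.limit))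
    (mink_vec_light origin s.limit), fun x => ?_⟩
  rw [tendsto_nhds_unique (key origin) (key x), div_mul_cancel₀ _ (mink_vec_light x _).ne']

/-- Distance-preserving maps preserve Gromov products, so the limits computed at `origin` and at `ψ
origin` coincide; the scales account for the denominators. -/
theorem mink_light_boundaryMap {ψ : Hyperboloid E → Hyperboloid F} (hψ : Isometry ψ)
    {ξ η : GromovBoundary (Hyperboloid E)} {c d : ℝ}
    (hc : ∀ x, mink (ψ x).vec (light (boundaryMap ψ hψ ξ)) = c * mink x.vec (light ξ))
    (hd : ∀ x, mink (ψ x).vec (light (boundaryMap ψ hψ η)) = d * mink x.vec (light η)) :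
    mink (light (boundaryMap ψ hψ ξ)) (light (boundaryMap ψ hψ η)) =
      c * d * mink (light ξ) (light η) := by
  obtain ⟨s, hs⟩ := exists_limit_eq ξ
  obtain ⟨t, ht⟩ := exists_limit_eq η
  obtain ⟨a1, a2⟩ := convergesToBoundary_iff.1 (hs ▸ convergesToBoundary_limit s)
  obtain ⟨b1, b2⟩ := convergesToBoundary_iff.1 (ht ▸ convergesToBoundary_limit t)
  obtain ⟨c1, c2⟩ := convergesToBoundary_iff.1 (hs ▸ convergesToBoundary_map hψ s)
  obtain ⟨d1, d2⟩ := convergesToBoundary_iff.1 (ht ▸ convergesToBoundary_map hψ t)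
  have h1 := tendsto_exp_gromovProduct a1 a2 b1 b2 origin
  have h2 := tendsto_exp_gromovProduct c1 c2 d1 d2 (ψ origin)
  simp only [gromovProduct, hψ.dist_eq] at h1 h2
  have h3 := tendsto_nhds_unique h1 h2
  change mink (light ξ) (light η) / (2 * mink origin.vec (light ξ) * mink origin.vec (light η)) =
    mink (light (boundaryMap ψ hψ ξ)) (light (boundaryMap ψ hψ η)) /
      (2 * mink (ψ origin).vec (light (boundaryMap ψ hψ ξ)) *
        mink (ψ origin).vec (light (boundaryMap ψ hψ η))) at h3
  have p1 := mink_vec_light origin ξ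
  have p2 := mink_vec_light origin η
  have p3 := mink_vec_light (ψ origin) (boundaryMap ψ hψ ξ)
  have p4 := mink_vec_light (ψ origin) (boundaryMap ψ hψ η)
  rw [div_eq_div_iff (by positivity) (by positivity), hc, hd] at h3
  have h4 : 2 * mink origin.vec (light ξ) * mink origin.vec (light η) ≠ 0 := by positivity
  refine mul_right_cancel₀ h4 ?_
  linear_combination -h3

/-- For each pair of distinct points the two maps have the same product of scales, and three points
then determine each positive scale. So `φ x` and `ψ x` have equal products with a total family of
light vectors. -/
theorem isometry_eq_of_boundaryMap_eq {f : Y → GromovBoundary (Hyperboloid E)}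
    {f' : Y → GromovBoundary (Hyperboloid F)} (hf : Function.Injective f)
    (hY : ∀ y : Y, ∃ a b : Y, y ≠ a ∧ y ≠ b ∧ a ≠ b)
    (hf' : (Submodule.span ℝ (light '' Set.range f')).topologicalClosure = ⊤)
    {φ ψ : Hyperboloid E → Hyperboloid F} (hφ : Isometry φ) (hψ : Isometry ψ)
    (h1 : ∀ y, f' y = boundaryMap φ hφ (f y)) (h2 : ∀ y, f' y = boundaryMap ψ hψ (f y)) :
    ψ = φ := by
  have hc : ∀ y, ∃ c : ℝ, 0 < c ∧ ∀ x, mink (φ x).vec (light (boundaryMap φ hφ (f y))) =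
      c * mink x.vec (light (f y)) := fun y => exists_mink_light_boundaryMap hφ (f y)
  have hd : ∀ y, ∃ c : ℝ, 0 < c ∧ ∀ x, mink (ψ x).vec (light (boundaryMap ψ hψ (f y))) =
      c * mink x.vec (light (f y)) := fun y => exists_mink_light_boundaryMap hψ (f y)
  choose c hc0 hc using hc
  choose d hd0 hd using hd
  have hcd : ∀ x y, x ≠ y → c x * c y = d x * d y := by
    intro x y hxy
    have e1 := mink_light_boundaryMap hφ (hc x) (hc y)
    have e2 := mink_light_boundaryMap hψ (hd x) (hd y)
    rw [← h1, ← h1] at e1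
    rw [← h2, ← h2, e1] at e2
    exact mul_right_cancel₀ (mink_light_pos fun h => hxy (hf h)).ne' e2
  have hcd' : ∀ y, c y = d y := by
    intro y
    obtain ⟨a, b, hya, hyb, hab⟩ := hY y
    have e1 := hcd y a hya
    have e2 := hcd y b hyb
    have e3 := hcd a b hab
    refine (pow_left_inj₀ (hc0 y).le (hd0 y).le two_ne_zero).1 ?_
    have h3 : c a * c b ≠ 0 := (mul_pos (hc0 a) (hc0 b)).ne'
    refine mul_right_cancel₀ h3 ?_
    calc c y ^ 2 * (c a * c b) = (c y * c a) * (c y * c b) := by ring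
      _ = d y ^ 2 * (d a * d b) := by rw [e1, e2]; ring
      _ = d y ^ 2 * (c a * c b) := by rw [e3]
  funext x
  refine vec_injective (sub_eq_zero.1 (eq_zero_of_mink_eq_zero_of_dense hf' ?_))
  rintro _ ⟨_, ⟨y, rfl⟩, rfl⟩
  have e1 := hc y x
  have e2 := hd y x
  rw [← h1] at e1
  rw [← h2] at e2
  rw [map_sub, LinearMap.sub_apply, e1, e2, hcd', sub_self]

end Extension

/-! ### Invariance of the Hilbert dimension -/

section Cardinality

variable {E : Type*} [NormedAddCommGroup E] [InnerProductSpace ℝ E]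

/-- Each `b i` has only countably many nonzero coefficients in `b'`, and each `b' j` meets some `b
i` since it is nonzero. So `ι'` is a union of countable sets indexed by `ι`. -/
theorem HilbertBasis.mk_le_of_infinite {ι ι' : Type u} (b : HilbertBasis ι ℝ E)
    (b' : HilbertBasis ι' ℝ E) [Infinite ι] : Cardinal.mk ι' ≤ Cardinal.mk ι := by
  let s : ι → Set ι' := fun i => {j | inner ℝ (b i) (b' j) ≠ 0}
  have hs : ∀ i, (s i).Countable := by
    intro i
    have h := (b'.summable_inner_mul_inner (b i) (b i)).countable_support
    refine h.mono fun j hj => ?_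
    simp only [s, Set.mem_ofPred_eq] at hj
    rw [Function.mem_support, real_inner_comm (b i)]
    exact mul_ne_zero hj hj
  have hU : (⋃ i, s i) = Set.univ := by
    refine Set.eq_univ_of_forall fun j => ?_
    by_contra h
    simp only [s, Set.mem_iUnion, Set.mem_ofPred_eq, not_exists, not_not] at h
    have h1 : b.repr (b' j) = 0 := by
      ext i
      rw [b.repr_apply_apply, h i]
      rfl
    have h2 : b' j = 0 := by simpa using h1
    have h3 := b'.orthonormal.1 j
    rw [h2, norm_zero] at h3
    exact zero_ne_one h3
  calc Cardinal.mk ι' = Cardinal.mk (⋃ i, s i) := by rw [hU, Cardinal.mk_univ]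
    _ ≤ Cardinal.mk ι * ⨆ i, Cardinal.mk (s i) := Cardinal.mk_iUnion_le _
    _ ≤ Cardinal.mk ι * Cardinal.aleph0 :=
        mul_le_mul' le_rfl (ciSup_le' fun i => Cardinal.le_aleph0_iff_set_countable.2 (hs i))
    _ = Cardinal.mk ι := Cardinal.mul_aleph0_eq (Cardinal.aleph0_le_mk ι)

/-- Two Hilbert bases have the same cardinality. -/
theorem HilbertBasis.mk_eq_mk {ι ι' : Type u} (b : HilbertBasis ι ℝ E)
    (b' : HilbertBasis ι' ℝ E) : Cardinal.mk ι = Cardinal.mk ι' := by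
  have fin : ∀ {ι ι' : Type u} (b : HilbertBasis ι ℝ E) (b' : HilbertBasis ι' ℝ E), Finite ι →
      Finite ι' := by
    intro ι ι' b b' h
    have := Fintype.ofFinite ι
    have : FiniteDimensional ℝ E := b.toOrthonormalBasis.toBasis.finiteDimensional_of_finite
    exact b'.orthonormal.linearIndependent.finite
  rcases finite_or_infinite ι with h | h
  · have h' := fin b b' h
    have := Fintype.ofFinite ι
    have := Fintype.ofFinite ι'
    have e1 := Module.finrank_eq_card_basis b.toOrthonormalBasis.toBasis
    have e2 := Module.finrank_eq_card_basis b'.toOrthonormalBasis.toBasis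
    rw [Cardinal.mk_fintype, Cardinal.mk_fintype, ← e1, e2]
  · rcases finite_or_infinite ι' with h' | h'
    · exact absurd (fin b' b h') (not_finite_iff_infinite.2 h)
    · exact le_antisymm (b'.mk_le_of_infinite b) (b.mk_le_of_infinite b')

theorem cardinal_eq_of_linearIsometryEquiv {κ κ' : Cardinal.{u}}
    (Φ : lp (fun _ : κ.out => ℝ) 2 ≃ₗᵢ[ℝ] lp (fun _ : κ'.out => ℝ) 2) : κ = κ' := by
  have b : HilbertBasis κ.out ℝ (lp (fun _ : κ.out => ℝ) 2) :=
    HilbertBasis.ofRepr (LinearIsometryEquiv.refl ℝ _)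
  have b' : HilbertBasis κ'.out ℝ (lp (fun _ : κ.out => ℝ) 2) := HilbertBasis.ofRepr Φ
  have := b.mk_eq_mk b'
  rwa [Cardinal.mk_out, Cardinal.mk_out] at this

end Cardinality

/-! ### Comparison of two realizations -/

section Main

variable {E : Type*} [NormedAddCommGroup E] [InnerProductSpace ℝ E] [CompleteSpace E]
  {F : Type*} [NormedAddCommGroup F] [InnerProductSpace ℝ F] [CompleteSpace F]
  {Y : Type*} [TopologicalSpace Y] {R : Y → Y → Y → Y → ℝ≥0∞}

/-- The quotient `ρ` of chordal distances satisfies the four-cycle identity because the cross-ratios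
agree, so it splits as `μ x * μ y`. Products of light vectors are half squares of chords, whence `l
= μ ^ 2`. -/
theorem exists_light_scaling (hY : 4 ≤ ENat.card Y) (hR : IsAbstractCrossRatio R)
    {f : Y → GromovBoundary (Hyperboloid E)} {f' : Y → GromovBoundary (Hyperboloid F)}
    (hf : ∀ (o : Hyperboloid E) (a b c d : Y), AtLeastThreeDistinct a b c d →
      boundaryCrossRatio o (f a) (f b) (f c) (f d) = R a b c d)
    (hf' : ∀ (o : Hyperboloid F) (a b c d : Y), AtLeastThreeDistinct a b c d →
      boundaryCrossRatio o (f' a) (f' b) (f' c) (f' d) = R a b c d) :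
    ∃ l : Y → ℝ, (∀ y, 0 < l y) ∧ ∀ x y, mink (light (f' x)) (light (f' y)) =
      l x * l y * mink (light (f x)) (light (f y)) := by
  let ρ : Y → Y → ℝ := fun x y => dist (dir (f' x)) (dir (f' y)) / dist (dir (f x)) (dir (f y))
  have hi := dir_injective.comp (injective_of_crossRatio_eq hY hR hf)
  have hi' := dir_injective.comp (injective_of_crossRatio_eq hY hR hf')
  have hd : ∀ x y, x ≠ y → 0 < dist (dir (f x)) (dir (f y)) := fun x y h =>
    dist_pos.2 fun h' => h (hi h')
  have hd' : ∀ x y, x ≠ y → 0 < dist (dir (f' x)) (dir (f' y)) := fun x y h =>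
    dist_pos.2 fun h' => h (hi' h')
  obtain ⟨w⟩ := nonempty_of_four_le_card hY
  obtain ⟨p, q, hwp, hwq, hpq⟩ := exists_ne_ne hY w
  obtain ⟨μ, hμ, h⟩ := exists_mul_of_four_cycle (ρ := ρ)
    (fun x y => by simp only [ρ, dist_comm]) (fun x y hxy => div_pos (hd' x y hxy) (hd x y hxy))
    (fun a b c d hq hab hcd had hcb => by
      have e := (hf origin a b c d hq).trans (hf' origin a b c d hq).symm
      rw [boundaryCrossRatio_eq, boundaryCrossRatio_eq] at e
      have e1 := congrArg ENNReal.toReal e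
      simp only [ENNReal.toReal_div, ENNReal.toReal_mul, edist_dist,
        ENNReal.toReal_ofReal dist_nonneg] at e1
      have h1 := hd a b hab
      have h2 := hd c d hcd
      have h3 := hd a d had
      have h4 := hd c b hcb
      have h3' := hd' a d had
      have h4' := hd' c b hcb
      simp only [ρ]
      rw [div_eq_div_iff (by positivity) (by positivity)] at e1
      rw [div_mul_div_comm, div_mul_div_comm, div_eq_div_iff (by positivity) (by positivity)]
      linear_combination -e1) hpq hwp.symm hwq.symm
  refine ⟨fun y => μ y ^ 2, fun y => pow_pos (hμ y) 2, fun x y => ?_⟩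
  rcases eq_or_ne x y with rfl | hxy
  · simp [mink_light_self]
  · have h1 := h x y hxy
    simp only [ρ] at h1
    rw [div_eq_iff (hd x y hxy).ne'] at h1
    rw [mink_light, mink_light, h1]
    ring

theorem exists_isometryEquiv_of_crossRatio_eq (hY : 4 ≤ ENat.card Y) (hR : IsAbstractCrossRatio R)
    {f : Y → GromovBoundary (Hyperboloid E)} {f' : Y → GromovBoundary (Hyperboloid F)}
    (hf : ∀ (o : Hyperboloid E) (a b c d : Y), AtLeastThreeDistinct a b c d →
      boundaryCrossRatio o (f a) (f b) (f c) (f d) = R a b c d)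
    (hf' : ∀ (o : Hyperboloid F) (a b c d : Y), AtLeastThreeDistinct a b c d →
      boundaryCrossRatio o (f' a) (f' b) (f' c) (f' d) = R a b c d)
    (ht : IsTotalBoundarySet (Set.range f)) (ht' : IsTotalBoundarySet (Set.range f')) :
    Nonempty (E ≃ₗᵢ[ℝ] F) ∧ ∃ φ : Hyperboloid E ≃ᵢ Hyperboloid F,
      (∀ y, f' y = boundaryMap φ φ.isometry (f y)) ∧
        ∀ (ψ : Hyperboloid E → Hyperboloid F) (hψ : Isometry ψ),
          (∀ y, f' y = boundaryMap ψ hψ (f y)) → ψ = φ := by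
  obtain ⟨l, hl, h⟩ := exists_light_scaling hY hR hf hf'
  obtain ⟨p⟩ := nonempty_of_four_le_card hY
  obtain ⟨q, -, hpq, -, -⟩ := exists_ne_ne hY p
  have hi := injective_of_crossRatio_eq hY hR hf
  have hi' := injective_of_crossRatio_eq hY hR hf'
  have hs := dense_span_of_isTotal ht
  have hs' := dense_span_of_isTotal ht'
  let u : Y → ℝ × E := fun y => l y • light (f y)
  let v : Y → ℝ × F := fun y => light (f' y)
  have huv : ∀ x y, mink (u x) (u y) = mink (v x) (v y) := by
    intro x y
    simp only [u, v, map_smul, LinearMap.smul_apply, smul_eq_mul, h]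
    ring
  have hu : (Submodule.span ℝ (Set.range u)).topologicalClosure = ⊤ := by
    refine eq_top_iff.2 (hs.symm.le.trans (Submodule.topologicalClosure_mono
      (Submodule.span_le.2 ?_)))
    rintro _ ⟨_, ⟨y, rfl⟩, rfl⟩
    exact (Submodule.smul_mem_iff _ (hl y).ne').1 (Submodule.subset_span ⟨y, rfl⟩)
  have hv : (Submodule.span ℝ (Set.range v)).topologicalClosure = ⊤ := by
    rw [← hs', ← Set.range_comp]
    rfl
  have hvv := mink_light_pos fun h => hpq (hi' h)
  have hm : mink (v p + v q) (v p + v q) = 2 * mink (v p) (v q) := by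
    simp only [map_add, LinearMap.add_apply, mink_comm (v q) (v p)]
    simp only [v, mink_light_self]
    ring
  have hm' : mink (u p + u q) (u p + u q) = 2 * mink (v p) (v q) := by
    rw [← hm]
    simp only [map_add, LinearMap.add_apply, huv]
  have hm0 : 0 < mink (v p + v q) (v p + v q) := by
    rw [hm]; positivity
  have hm0' : 0 < mink (u p + u q) (u p + u q) := by
    rw [hm']; positivity
  have hp1 : 0 < (v p + v q).1 := by simp [v, light]
  have hp1' : 0 < (u p + u q).1 := by
    have := hl p
    have := hl q
    simp only [u, light, Prod.fst_add, Prod.smul_fst, smul_eq_mul, mul_one]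
    positivity
  obtain ⟨hΦ, T, hT, hTu, hTz⟩ := exists_minkowskiEquiv huv hu hv
    -- The sum of two light vectors on distinct rays is timelike. The normalized sums correspond to
    -- each other, because the Gram matrices agree.
    (normalize _ hp1' hm0') (normalize _ hp1 hm0) (fun y => by
      rw [vec_normalize, vec_normalize, hm, hm']
      simp only [map_smul, LinearMap.smul_apply, map_add, LinearMap.add_apply, huv])
  obtain ⟨φ, hφ⟩ := exists_isometryEquiv T hT hTz
  have hφf : ∀ y, f' y = boundaryMap φ φ.isometry (f y) := by
    intro y
    refine (boundaryMap_eq_of_light φ.isometry hφ (inv_pos.2 (hl y)) ?_).symm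
    have : light (f y) = (l y)⁻¹ • u y := by
      simp only [u, smul_smul, inv_mul_cancel₀ (hl y).ne', one_smul]
    rw [this, map_smul, hTu]
  exact ⟨hΦ, φ, hφf, fun ψ hψ hψf =>
    isometry_eq_of_boundaryMap_eq hi (exists_ne_ne hY) hs' φ.isometry hψ hφf hψf⟩

end Main

end Uniqueness

end
-- The GNS theorem for algebraic cross-ratios
theorem mainTheorem5 {Y : Type u} [TopologicalSpace Y] (hY : 4 ≤ ENat.card Y)
    (R : Y → Y → Y → Y → ℝ≥0∞) (hR : IsAlgebraicCrossRatio R) :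
    (∃ (κ : Cardinal.{u}) (f : Y → GromovBoundary (AlgHyperbolicSpace κ)),
      RealizesCrossRatio R κ f) ∧
    (∀ (κ₁ κ₂ : Cardinal.{u}) (f₁ : Y → GromovBoundary (AlgHyperbolicSpace κ₁))
      (f₂ : Y → GromovBoundary (AlgHyperbolicSpace κ₂)),
      RealizesCrossRatio R κ₁ f₁ → RealizesCrossRatio R κ₂ f₂ →
      κ₁ = κ₂ ∧
      ∃ φ : AlgHyperbolicSpace κ₁ ≃ᵢ AlgHyperbolicSpace κ₂,
        (∀ y, f₂ y = boundaryMap φ φ.isometry (f₁ y)) ∧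
        ∀ (ψ : AlgHyperbolicSpace κ₁ → AlgHyperbolicSpace κ₂) (hψ : Isometry ψ),
          (∀ y, f₂ y = boundaryMap ψ hψ (f₁ y)) → ψ = φ) ∧
    (∀ (Γ : Type v) [Group Γ] [MulAction Γ Y],
      (∀ (g : Γ) (a b c d : Y), AtLeastThreeDistinct a b c d →
        R (g • a) (g • b) (g • c) (g • d) = R a b c d) →
      ∀ (κ : Cardinal.{u}) (f : Y → GromovBoundary (AlgHyperbolicSpace κ)),
        RealizesCrossRatio R κ f →
        ∃ ρ : Γ →* (AlgHyperbolicSpace κ ≃ᵢ AlgHyperbolicSpace κ),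
          ∀ (g : Γ) (y : Y), f (g • y) = boundaryMap (ρ g) (ρ g).isometry (f y)) := by
  have hA := hR.toIsAbstractCrossRatio
  refine ⟨exists_realizesCrossRatio hY hR, ?_, ?_⟩
  · intro κ₁ κ₂ f₁ f₂ h₁ h₂
    obtain ⟨⟨Φ⟩, h⟩ := exists_isometryEquiv_of_crossRatio_eq hY hA h₁.crossRatio_eq
      h₂.crossRatio_eq h₁.total h₂.total
    exact ⟨cardinal_eq_of_linearIsometryEquiv Φ, h⟩
  · intro Γ _ _ hΓ κ f hf
    have hex : ∀ g : Γ, ∃ φ : AlgHyperbolicSpace κ ≃ᵢ AlgHyperbolicSpace κ,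
        (∀ y, f (g • y) = boundaryMap φ φ.isometry (f y)) ∧
        ∀ (ψ : AlgHyperbolicSpace κ → AlgHyperbolicSpace κ) (hψ : Isometry ψ),
          (∀ y, f (g • y) = boundaryMap ψ hψ (f y)) → ψ = φ := by
      intro g
      -- Translating by `g` gives a second realization of `R` with the same image; injectivity of
      -- the translation keeps quadruples in `Y⁽⁴⁾`.
      have hinj : Function.Injective fun y : Y => g • y := MulAction.injective g
      have hrange : Set.range (fun y => f (g • y)) = Set.range f :=
        (MulAction.surjective g).range_comp f
      refine (exists_isometryEquiv_of_crossRatio_eq hY hA hf.crossRatio_eq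
        (f' := fun y => f (g • y)) (fun o a b c d h => ?_) hf.total (hrange ▸ hf.total)).2
      rw [hf.crossRatio_eq o, hΓ g a b c d h]
      unfold AtLeastThreeDistinct at h ⊢
      simpa only [hinj.ne_iff] using h
    choose ρ hρ huniq using hex
    refine ⟨MonoidHom.mk' ρ fun g g' => ?_, hρ⟩
    refine IsometryEquiv.ext fun x => ?_
    -- Both `ρ (g * g')` and `ρ g ∘ ρ g'` induce the action of `g * g'` on the image of `f`, so
    -- uniqueness identifies them.
    refine (congrFun (huniq (g * g') _ ((ρ g).isometry.comp (ρ g').isometry) fun y => ?_) x).symm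
    rw [mul_smul, hρ g, hρ g']
    induction f y using Quot.ind
    rfl
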